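/- Let $n\ge 1$, let $\langle\cdot,\cdot\rangle$ be the Euclidean inner product on $\mathbb{R}^n$, and let $du$ denote surface measure ($(n-1)$-dimensional Hausdorff measure) on the unit sphere $S^{n-1}$. Let $\Omega\subset S^{n-1}$ be a closed set not contained in any closed hemisphere, and let $C^+(\Omega)$ be the set of strictly positive continuous functions on $\Omega$. For $f\in C^+(\Omega)$ let $[f]=\bigcap_{u\in\Omega}\{x\in\mathbb{R}^n:\langle x,u\rangle\le f(u)\}$ be its Aleksandrov body; it is a compact convex set containing the origin in its interior. For such a convex body $K$ let $h_K(u)=\sup_{x\in K}\langle u,x\rangle$ and $\rho_K(u)=\sup\{\lambda>0:\lambda u\in K\}$, $u\in S^{n-1}$, be its support and radial functions, and for $E\subset S^{n-1}$ let $$\boldsymbol{\alpha}^*_K(E)=\{x/|x|:\ x\in\partial K,\ \langle x,u\rangle=h_K(u)\text{ for some }u\in E\}.$$ Let $G:(0,\infty)\times S^{n-1}\to\mathbb{R}$ be continuous with a partial derivative $G_t=\partial G/\partial t$ that exists and is continuous on $(0,\infty)\times S^{n-1}$. Put $$\widetilde V_G(K)=\int_{S^{n-1}}G(\rho_K(u),u)\,du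 .$$ The formula $$\widetilde C_G(K,E)=\frac1n\int_{\boldsymbol{\alpha}^*_K(E)}\rho_K(u)\,G_t(\rho_K(u),u)\,du,\qquad E\subset S^{n-1}\text{ Borel},$$ defines a finite signed Borel measure $\widetilde C_G(K,\cdot)$ on $S^{n-1}$ (for $K=[f]$, $f\in C^+(\Omega)$; the sets $\boldsymbol{\alpha}^*_K(E)$ are measurable with respect to the completion of surface measure). Let $\mathcal I$ (respectively $\mathcal D$) be the class of continuous, strictly increasing (respectively strictly decreasing) functions $\varphi:(0,\infty)\to(0,\infty)$ with $\varphi(1)=1$, $\lim_{t\to0^+}\varphi(t)=0$ and $\lim_{t\to\infty}\varphi(t)=\infty$ (respectively $\varphi(1)=1$, $\lim_{t\to0^+}\varphi(t)=\infty$ and $\lim_{t\to\infty}\varphi(t)=0$). **Theorem.** Let $h_1,h_2\in C^+(\Omega)$, and let either $\varphi_1,\varphi_2\in\mathcal I$ or $\varphi_1,\varphi_2\in\mathcal D$. Suppose that $\varphi_1$ and $\varphi_2$ are continuously differentiable with $\varphi_1'$ and $\varphi_2'$ nonzero on $(0,\infty)$. For $\varepsilon>0$ let $h_\varepsilon:\Omega\to(0,\infty)$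 be the function defined (implicitly and uniquely) by $$\varphi_1\!\left(\frac{h_1(u)}{h_\varepsilon(u)}\right)+\varepsilon\,\varphi_2\!\left(\frac{h_2(u)}{h_\varepsilon(u)}\right)=1,\qquad u\in\Omega .$$ Then $$\lim_{\varepsilon\to0^+}\frac{\widetilde V_G([h_\varepsilon])-\widetilde V_G([h_1])}{\varepsilon}=\frac{n}{\varphi_1'(1)}\int_\Omega\varphi_2\!\left(\frac{h_2(u)}{h_1(u)}\right)d\widetilde C_G([h_1],u).$$ -/

import Mathlib

open Set Filter Topology MeasureTheory
open scoped RealInnerProductSpace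

noncomputable section

namespace DualOrlicz

/-- The unit sphere `S^{n-1}` of `ℝⁿ`. -/
abbrev Sph (n : ℕ) : Type := Metric.sphere (0 : EuclideanSpace ℝ (Fin n)) 1

/-- The surface measure `du` on `S^{n-1}`, that is, the `(n-1)`-dimensional Hausdorff measure
normalized as usual, so that a Borel set `A` has measure `n` times the Lebesgue measure of the
cone `{r u : 0 < r < 1, u ∈ A}`. -/
abbrev sphMeasure (n : ℕ) : Measure (Sph n) :=
  (volume : Measure (EuclideanSpace ℝ (Fin n))).toSphere

/-- The class `𝓘`: continuous strictly increasing functions `(0, ∞) → (0, ∞)` with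
`φ(1) = 1`, `φ(0+) = 0`, `φ(∞) = ∞`. Only the values on `(0, ∞)` matter. -/
structure IsClassI (φ : ℝ → ℝ) : Prop where
  pos : ∀ t, 0 < t → 0 < φ t
  cont : ContinuousOn φ (Ioi 0)
  mono : StrictMonoOn φ (Ioi 0)
  one : φ 1 = 1
  zero : Tendsto φ (𝓝[>] 0) (𝓝 0)
  top : Tendsto φ atTop atTop

/-- The class `𝓓`: continuous strictly decreasing functions `(0, ∞) → (0, ∞)` with
`φ(1) = 1`, `φ(0+) = ∞`, `φ(∞) = 0`. Only the values on `(0, ∞)` matter. -/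
structure IsClassD (φ : ℝ → ℝ) : Prop where
  pos : ∀ t, 0 < t → 0 < φ t
  cont : ContinuousOn φ (Ioi 0)
  anti : StrictAntiOn φ (Ioi 0)
  one : φ 1 = 1
  zero : Tendsto φ (𝓝[>] 0) atTop
  top : Tendsto φ atTop (𝓝 0)

variable {n : ℕ}

/-- `Ω ⊆ S^{n-1}` is closed and not contained in any closed hemisphere
`{u : ⟨u, v⟩ ≥ 0}`, `v ∈ S^{n-1}`. -/
def IsAdmissibleDomain (Ω : Set (Sph n)) : Prop :=
  IsClosed Ω ∧ ∀ v : Sph n, ¬ Ω ⊆ {u : Sph n | 0 ≤ ⟪(u : EuclideanSpace ℝ (Fin n)), v⟫}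

/-- `f ∈ C⁺(Ω)`: continuous and strictly positive on `Ω`. -/
def IsCPos (Ω : Set (Sph n)) (f : Sph n → ℝ) : Prop :=
  ContinuousOn f Ω ∧ ∀ u ∈ Ω, 0 < f u

/-- The Aleksandrov body (Wulff shape) `[f] = ⋂_{u ∈ Ω} {x : ⟨x, u⟩ ≤ f u}`. -/
def aleksandrovBody (Ω : Set (Sph n)) (f : Sph n → ℝ) : Set (EuclideanSpace ℝ (Fin n)) :=
  ⋂ u ∈ Ω, {x | ⟪x, (u : EuclideanSpace ℝ (Fin n))⟫ ≤ f u}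

/-- `f` is the function `h_ε` on `Ω` defined implicitly by
`φ₁(h₁ / h_ε) + ε φ₂(h₂ / h_ε) = 1`. -/
def IsOrliczCombination (Ω : Set (Sph n)) (φ₁ φ₂ : ℝ → ℝ) (h₁ h₂ : Sph n → ℝ) (ε : ℝ)
    (f : Sph n → ℝ) : Prop :=
  ∀ u ∈ Ω, 0 < f u ∧ φ₁ (h₁ u / f u) + ε * φ₂ (h₂ u / f u) = 1

/-- The support function `h_K(u) = sup_{x ∈ K} ⟨u, x⟩`. -/
def supportFn (K : Set (EuclideanSpace ℝ (Fin n))) (u : Sph n) : ℝ :=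
  sSup ((fun x => ⟪(u : EuclideanSpace ℝ (Fin n)), x⟫) '' K)

/-- The radial function `ρ_K(u) = sup {r > 0 : r u ∈ K}`. -/
def radialFn (K : Set (EuclideanSpace ℝ (Fin n))) (u : Sph n) : ℝ :=
  sSup {r : ℝ | 0 < r ∧ r • (u : EuclideanSpace ℝ (Fin n)) ∈ K}

/-- The general dual volume `Ṽ_G(K) = ∫ G(ρ_K(u), u) du`. -/
def dualVolume (G : ℝ → Sph n → ℝ) (K : Set (EuclideanSpace ℝ (Fin n))) : ℝ :=
  ∫ u, G (radialFn K u) u ∂(sphMeasure n)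

/-- The partial derivative `G_t(t, u) = ∂G(t, u)/∂t`. -/
def partialT (G : ℝ → Sph n → ℝ) (t : ℝ) (u : Sph n) : ℝ :=
  deriv (fun s => G s u) t

/-- The supporting hyperplane `H(K, u) = {x : ⟨x, u⟩ = h_K(u)}`. -/
def supportingHyperplane (K : Set (EuclideanSpace ℝ (Fin n))) (u : Sph n) :
    Set (EuclideanSpace ℝ (Fin n)) :=
  {x | ⟪x, (u : EuclideanSpace ℝ (Fin n))⟫ = supportFn K u}

/-- The reverse radial Gauss image
`α*_K(E) = {x / |x| : x ∈ ∂K ∩ H(K, u) for some u ∈ E}`. -/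
def reverseRadialGaussImage (K : Set (EuclideanSpace ℝ (Fin n))) (E : Set (Sph n)) :
    Set (Sph n) :=
  {v | ∃ u ∈ E, ∃ x ∈ frontier K ∩ supportingHyperplane K u,
    (v : EuclideanSpace ℝ (Fin n)) = ‖x‖⁻¹ • x}

/-- The set function
`E ↦ (1/n) ∫_{α*_K(E)} ρ_K(u) G_t(ρ_K(u), u) du` (the case `ψ ≡ 1`). -/
def dualCurvatureSetFn (G : ℝ → Sph n → ℝ) (K : Set (EuclideanSpace ℝ (Fin n)))
    (E : Set (Sph n)) : ℝ :=
  (1 / (n : ℝ)) * ∫ u in reverseRadialGaussImage K E,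
    radialFn K u * partialT G (radialFn K u) u ∂(sphMeasure n)

open Classical in
/-- The general dual Orlicz curvature measure `C̃_G(K, ·)`: the finite signed Borel measure on
`S^{n-1}` whose value on each Borel set `E` is `dualCurvatureSetFn G K E`. Such a signed measure
is unique; the value `0` is used where there is none. -/
def dualCurvatureMeasure (G : ℝ → Sph n → ℝ) (K : Set (EuclideanSpace ℝ (Fin n))) :
    SignedMeasure (Sph n) :=
  if h : ∃ μ : SignedMeasure (Sph n), ∀ E, MeasurableSet E → μ E = dualCurvatureSetFn G K E
  then h.choose else 0

/-- The defining equation of `h_ε` has exactly one positive solution at every point. -/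
theorem existsUnique_orlicz {φ₁ φ₂ : ℝ → ℝ}
    (hφ : (IsClassI φ₁ ∧ IsClassI φ₂) ∨ (IsClassD φ₁ ∧ IsClassD φ₂))
    {a b ε : ℝ} (ha : 0 < a) (hb : 0 < b) (hε : 0 < ε) :
    ∃! x : ℝ, 0 < x ∧ φ₁ (a / x) + ε * φ₂ (b / x) = 1 := by
  -- work with `s = 1 / x`
  suffices h : ∃! s : ℝ, 0 < s ∧ φ₁ (a * s) + ε * φ₂ (b * s) = 1 by
    obtain ⟨s, ⟨hs, hs1⟩, huniq⟩ := h
    refine ⟨s⁻¹, ⟨inv_pos.2 hs, by simpa [div_eq_mul_inv] using hs1⟩, ?_⟩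
    rintro y ⟨hy, hy1⟩
    have := huniq y⁻¹ ⟨inv_pos.2 hy, by simpa [div_eq_mul_inv] using hy1⟩
    rw [← this, inv_inv]
  have hmem : ∀ c : ℝ, 0 < c → ∀ s ∈ Ioi (0 : ℝ), c * s ∈ Ioi (0 : ℝ) :=
    fun c hc s hs => mul_pos hc hs
  have hzero : ∀ c : ℝ, 0 < c → Tendsto (fun s : ℝ => c * s) (𝓝[>] 0) (𝓝[>] 0) := by
    intro c hc
    refine tendsto_nhdsWithin_iff.2 ⟨?_, ?_⟩
    · have : Tendsto (fun s : ℝ => c * s) (𝓝 0) (𝓝 (c * 0)) :=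
        (continuous_const.mul continuous_id).tendsto 0
      rw [mul_zero] at this
      exact this.mono_left nhdsWithin_le_nhds
    · filter_upwards [self_mem_nhdsWithin] with s hs using hmem c hc s hs
  have htop : ∀ c : ℝ, 0 < c → Tendsto (fun s : ℝ => c * s) atTop atTop :=
    fun c hc => tendsto_id.const_mul_atTop hc
  set F : ℝ → ℝ := fun s => φ₁ (a * s) + ε * φ₂ (b * s) with hF
  have hsub : ∀ {s t : ℝ}, s ∈ Ioi (0 : ℝ) → t ∈ Ioi (0 : ℝ) → uIcc s t ⊆ Ioi 0 :=
    fun hs ht => ordConnected_Ioi.uIcc_subset hs ht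
  have key : ∀ s t : ℝ, 0 < s → 0 < t → ContinuousOn F (Ioi 0) → InjOn F (Ioi 0) →
      F s < 1 → 1 < F t → ∃! s : ℝ, 0 < s ∧ F s = 1 := by
    intro s t hs ht hc hinj h1 h2
    obtain ⟨r, hr, hr1⟩ := intermediate_value_uIcc (hc.mono (hsub hs ht))
      (mem_uIcc.2 (Or.inl ⟨h1.le, h2.le⟩) : (1 : ℝ) ∈ uIcc (F s) (F t))
    refine ⟨r, ⟨hsub hs ht hr, hr1⟩, ?_⟩
    rintro y ⟨hy, hy1⟩
    exact hinj hy (hsub hs ht hr) (hy1.trans hr1.symm)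
  rcases hφ with ⟨h1, h2⟩ | ⟨h1, h2⟩
  · have hc : ContinuousOn F (Ioi 0) :=
      (h1.cont.comp (continuous_const.mul continuous_id).continuousOn (hmem a ha)).add
        (continuousOn_const.mul
          (h2.cont.comp (continuous_const.mul continuous_id).continuousOn (hmem b hb)))
    have hm : StrictMonoOn F (Ioi 0) := by
      intro s hs t ht hst
      have e1 := h1.mono (hmem a ha s hs) (hmem a ha t ht) (mul_lt_mul_of_pos_left hst ha)
      have e2 := h2.mono (hmem b hb s hs) (hmem b hb t ht) (mul_lt_mul_of_pos_left hst hb)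
      exact add_lt_add e1 (mul_lt_mul_of_pos_left e2 hε)
    have l0 : Tendsto F (𝓝[>] 0) (𝓝 (0 + ε * 0)) :=
      (h1.zero.comp (hzero a ha)).add ((h2.zero.comp (hzero b hb)).const_mul ε)
    have l1 : Tendsto F atTop atTop :=
      (h1.top.comp (htop a ha)).atTop_add_atTop
        ((h2.top.comp (htop b hb)).const_mul_atTop hε)
    obtain ⟨s, hs, hs0⟩ := ((l0.eventually (gt_mem_nhds (by simp : (0 : ℝ) + ε * 0 < 1))).and
      (self_mem_nhdsWithin : Ioi (0 : ℝ) ∈ 𝓝[>] (0 : ℝ))).exists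
    obtain ⟨t, ht, ht0⟩ := ((l1.eventually (eventually_gt_atTop 1)).and
      (eventually_gt_atTop 0)).exists
    exact key s t hs0 ht0 hc hm.injOn hs ht
  · have hc : ContinuousOn F (Ioi 0) :=
      (h1.cont.comp (continuous_const.mul continuous_id).continuousOn (hmem a ha)).add
        (continuousOn_const.mul
          (h2.cont.comp (continuous_const.mul continuous_id).continuousOn (hmem b hb)))
    have hm : StrictAntiOn F (Ioi 0) := by
      intro s hs t ht hst
      have e1 := h1.anti (hmem a ha s hs) (hmem a ha t ht) (mul_lt_mul_of_pos_left hst ha)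
      have e2 := h2.anti (hmem b hb s hs) (hmem b hb t ht) (mul_lt_mul_of_pos_left hst hb)
      exact add_lt_add e1 (mul_lt_mul_of_pos_left e2 hε)
    have l0 : Tendsto F (𝓝[>] 0) atTop :=
      (h1.zero.comp (hzero a ha)).atTop_add_atTop
        ((h2.zero.comp (hzero b hb)).const_mul_atTop hε)
    have l1 : Tendsto F atTop (𝓝 (0 + ε * 0)) :=
      (h1.top.comp (htop a ha)).add ((h2.top.comp (htop b hb)).const_mul ε)
    obtain ⟨t, ht, ht0⟩ := ((l0.eventually (eventually_gt_atTop 1)).and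
      (self_mem_nhdsWithin : Ioi (0 : ℝ) ∈ 𝓝[>] (0 : ℝ))).exists
    obtain ⟨s, hs, hs0⟩ := ((l1.eventually (gt_mem_nhds (by simp : (0 : ℝ) + ε * 0 < 1))).and
      (eventually_gt_atTop 0)).exists
    exact key s t hs0 ht0 hc hm.injOn hs ht

end DualOrlicz

end

/-!
The radial function of a convex body `K` around the origin is the reciprocal of its gauge. The
gauge is Lipschitz, so by Rademacher's theorem it is differentiable in almost every direction `v`,
and there its normalised gradient is the only outer unit normal of `K` at the boundary point
`ρ_K(v) v`. Hence `α*_K(E)` agrees almost everywhere with the preimage of `E` under this radial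
Gauss map, and `C̃_G(K, ·)` is the push-forward of `(1/n) ρ_K G_t(ρ_K, ·) du`.

The gauge of `[h]` at `x` is the maximum of `⟨x, w⟩ / h w` over `w ∈ Ω`, attained at the radial
Gauss image of `x`. By Danskin's theorem, only the maximiser contributes to the derivative of the
gauge of `[h_ε]` in `ε` where it is unique, which is almost everywhere. The Orlicz equation gives
`h₁ / h_ε = 1 - ε φ₂(h₂ / h₁) / φ₁'(1) + o(ε)` uniformly on `Ω`, and dominated convergence
integrates the resulting derivative of `ρ` over the sphere.
-/

noncomputable section

namespace DualOrlicz

theorem abs_ciSup_sub_ciSup_le {ι : Type*} [Nonempty ι] {f g : ι → ℝ} {C : ℝ}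
    (hg : BddAbove (range g)) (h : ∀ i, |f i - g i| ≤ C) :
    |(⨆ i, f i) - ⨆ i, g i| ≤ C := by
  have hf_le (i : ι) : f i ≤ (⨆ i, g i) + C := by
    linarith [(abs_le.1 (h i)).2, le_ciSup hg i]
  have hg_le (i : ι) : g i ≤ (⨆ i, f i) + C := by
    linarith [(abs_le.1 (h i)).1, le_ciSup ⟨_, forall_mem_range.2 hf_le⟩ i]
  exact abs_le.2 ⟨by linarith [ciSup_le hg_le], by linarith [ciSup_le hf_le]⟩

section Danskin

variable {X : Type*} [TopologicalSpace X] {K : Set X} {a b : X → ℝ} {w : X}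

theorem tendsto_of_isMaxOn_add_mul (hK : IsCompact K) (ha : ContinuousOn a K)
    (hb : ContinuousOn b K) (huniq : ∀ y ∈ K, IsMaxOn a K y → y = w) {y : ℝ → X}
    (hyK : ∀ t, y t ∈ K) (hy : ∀ t, IsMaxOn (fun x => a x + t * b x) K (y t)) :
    Tendsto y (𝓝 0) (𝓝 w) := by
  refine hK.tendsto_nhds_of_unique_mapClusterPt (Eventually.of_forall hyK) fun z hz hcluster => ?_
  obtain ⟨U, hU, hyz⟩ := mapClusterPt_iff_ultrafilter.1 hcluster
  have hyzK : Tendsto y U (𝓝[K] z) :=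
    tendsto_nhdsWithin_iff.2 ⟨hyz, Eventually.of_forall hyK⟩
  refine huniq z hz fun x hx => ?_
  have hlim (c : ℝ → ℝ) (d : ℝ → ℝ) {p q : ℝ} (hc : Tendsto c U (𝓝 p)) (hd : Tendsto d U (𝓝 q)) :
      Tendsto (fun t => c t + t * d t) U (𝓝 p) := by
    simpa using hc.add ((tendsto_id.mono_left hU).mul hd)
  exact le_of_tendsto_of_tendsto'
    (hlim _ _ tendsto_const_nhds tendsto_const_nhds)
    (hlim _ _ ((ha z hz).tendsto.comp hyzK) ((hb z hz).tendsto.comp hyzK)) fun t => hy t hx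

theorem hasDerivAt_iSup_add_mul (hK : IsCompact K) (ha : ContinuousOn a K)
    (hb : ContinuousOn b K) (hw : w ∈ K) (huniq : ∀ y ∈ K, IsMaxOn a K y → y = w) :
    HasDerivAt (fun t : ℝ => ⨆ x : K, (a x + t * b x)) (b w) 0 := by
  have hexists (t : ℝ) : ∃ y ∈ K, IsMaxOn (fun x => a x + t * b x) K y :=
    hK.exists_isMaxOn ⟨w, hw⟩ (ha.add (continuousOn_const.mul hb))
  choose y hyK hy using hexists
  have hwmax : IsMaxOn a K w := by
    have h0 : IsMaxOn a K (y 0) := by simpa using hy 0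
    exact huniq _ (hyK 0) h0 ▸ h0
  have hF (t : ℝ) : ⨆ x : K, (a x + t * b x) = a (y t) + t * b (y t) :=
    (hy t).iSup_eq (hyK t)
  have hF0 : ⨆ x : K, (a x + 0 * b x) = a w := by simpa using hwmax.iSup_eq hw
  have hyw : Tendsto y (𝓝 0) (𝓝[K] w) := tendsto_nhdsWithin_iff.2
    ⟨tendsto_of_isMaxOn_add_mul hK ha hb huniq hyK hy, Eventually.of_forall hyK⟩
  have hbw : Tendsto (fun t => b (y t) - b w) (𝓝 0) (𝓝 0) := by
    simpa using ((hb w hw).tendsto.comp hyw).sub_const (b w)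
  rw [hasDerivAt_iff_isLittleO_nhds_zero]
  -- The error at `t` lies between `0` and `t * (b (y t) - b w)`.
  refine Asymptotics.IsBigO.trans_isLittleO (g := fun t => t * (b (y t) - b w))
    (.of_bound' (Eventually.of_forall fun t => ?_)) ?_
  · have hlower : a w + t * b w ≤ a (y t) + t * b (y t) := hy t hw
    have hupper : a (y t) ≤ a w := hwmax (hyK t)
    simp only [zero_add, hF0, hF t, smul_eq_mul, Real.norm_eq_abs]
    exact abs_le_abs_of_nonneg (by linarith) (by linarith)
  · simpa using (Asymptotics.isBigO_refl (fun t : ℝ => t) (𝓝 0)).mul_isLittleO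
      ((Asymptotics.isLittleO_one_iff ℝ).2 hbw)

theorem hasDerivWithinAt_iSup_of_tendstoUniformlyOn {A : ℝ → X → ℝ} (hK : IsCompact K)
    (hA : ContinuousOn (A 0) K) (hb : ContinuousOn b K) (hw : w ∈ K)
    (huniq : ∀ y ∈ K, IsMaxOn (A 0) K y → y = w)
    (hunif : TendstoUniformlyOn (fun t x => (A t x - A 0 x) / t) b (𝓝[>] 0) K) :
    HasDerivWithinAt (fun t => ⨆ x : K, A t x) (b w) (Ioi 0) 0 := by
  have : Nonempty K := ⟨⟨w, hw⟩⟩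
  have haffine := (hasDerivAt_iSup_add_mul hK hA hb hw huniq).hasDerivWithinAt (s := Ioi 0)
  have herror : (fun t => (⨆ x : K, A t x) - ⨆ x : K, (A 0 x + t * b x)) =o[𝓝[>] 0]
      fun t : ℝ => t := by
    refine Asymptotics.isLittleO_iff.2 fun δ hδ => ?_
    filter_upwards [Metric.tendstoUniformlyOn_iff.1 hunif δ hδ, self_mem_nhdsWithin]
      with t ht (htpos : 0 < t)
    have hbdd : BddAbove (range fun x : K => A 0 x + t * b x) := by
      rw [← image_eq_range fun x => A 0 x + t * b x]
      exact hK.bddAbove_image (hA.add (continuousOn_const.mul hb))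
    refine abs_ciSup_sub_ciSup_le hbdd fun x => ?_
    have hdiff : A t x - (A 0 x + t * b x) = ((A t x - A 0 x) / t - b x) * t := by
      field_simp
      ring
    rw [hdiff, abs_mul, ← Real.dist_eq, dist_comm]
    exact mul_le_mul_of_nonneg_right (ht x x.2).le (abs_nonneg t)
  rw [hasDerivWithinAt_iff_isLittleO] at haffine ⊢
  refine (haffine.add (by simpa using herror)).congr_left fun t => ?_
  simp only [sub_zero, smul_eq_mul, zero_mul, add_zero]
  ring

end Danskin

section OrliczExpansion

section StrictMono

variable {ι α β : Type*} {l : Filter ι} [LinearOrder α] [TopologicalSpace α] [OrderTopology α]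
  [DenselyOrdered α] [NoMinOrder α] [NoMaxOrder α] [LinearOrder β] [TopologicalSpace β]
  [OrderTopology β] {f : α → β} {s : Set α} {x : α} {a : ι → α}

theorem tendsto_of_strictMonoOn (hf : StrictMonoOn f s) (hs : s ∈ 𝓝 x) (ha : ∀ᶠ i in l, a i ∈ s)
    (hlim : Tendsto (fun i => f (a i)) l (𝓝 (f x))) : Tendsto a l (𝓝 x) := by
  have hxs : x ∈ s := mem_of_mem_nhds hs
  refine tendsto_order.2 ⟨fun y hy => ?_, fun y hy => ?_⟩
  · obtain ⟨z, hzs, hyz, hzx⟩ :=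
      Filter.nonempty_of_mem (inter_mem (mem_nhdsWithin_of_mem_nhds hs) (Ioo_mem_nhdsLT hy))
    filter_upwards [ha, hlim.eventually_const_lt (hf hzs hxs hzx)] with i his hi
    exact hyz.trans ((hf.lt_iff_lt hzs his).1 hi)
  · obtain ⟨z, hzs, hxz, hzy⟩ :=
      Filter.nonempty_of_mem (inter_mem (mem_nhdsWithin_of_mem_nhds hs) (Ioo_mem_nhdsGT hy))
    filter_upwards [ha, hlim.eventually_lt_const (hf hxs hzs hxz)] with i his hi
    exact ((hf.lt_iff_lt his hzs).1 hi).trans hzy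

theorem tendsto_of_strictAntiOn (hf : StrictAntiOn f s) (hs : s ∈ 𝓝 x) (ha : ∀ᶠ i in l, a i ∈ s)
    (hlim : Tendsto (fun i => f (a i)) l (𝓝 (f x))) : Tendsto a l (𝓝 x) :=
  tendsto_of_strictMonoOn hf.dual_right hs ha hlim

end StrictMono

/-- What the expansion of the Orlicz combination needs from the pair `(φ₁, φ₂)`; it is shared by
the class `𝓘`, where both functions increase, and the class `𝓓`, where both decrease. -/
structure IsOrliczPair (φ₁ φ₂ : ℝ → ℝ) : Prop where
  monotone : (StrictMonoOn φ₁ (Ioi 0) ∧ MonotoneOn φ₂ (Ioi 0)) ∨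
    (StrictAntiOn φ₁ (Ioi 0) ∧ AntitoneOn φ₂ (Ioi 0))
  one : φ₁ 1 = 1
  nonneg : ∀ t, 0 < t → 0 ≤ φ₂ t
  cont : ContinuousOn φ₂ (Ioi 0)

variable {φ₁ φ₂ : ℝ → ℝ}

theorem isOrliczPair_of_classes
    (hφ : (IsClassI φ₁ ∧ IsClassI φ₂) ∨ (IsClassD φ₁ ∧ IsClassD φ₂)) : IsOrliczPair φ₁ φ₂ := by
  rcases hφ with ⟨h₁, h₂⟩ | ⟨h₁, h₂⟩
  · exact ⟨.inl ⟨h₁.mono, h₂.mono.monotoneOn⟩, h₁.one, fun t ht => (h₂.pos t ht).le, h₂.cont⟩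
  · exact ⟨.inr ⟨h₁.anti, h₂.anti.antitoneOn⟩, h₁.one, fun t ht => (h₂.pos t ht).le, h₂.cont⟩

theorem orlicz_apply_mul_le (hφ : IsOrliczPair φ₁ φ₂) {ε a k : ℝ} (hε : 0 < ε) (ha : 0 < a)
    (hk : 0 < k) (heq : φ₁ a + ε * φ₂ (k * a) = 1) : φ₂ (k * a) ≤ φ₂ k := by
  have hka : 0 < k * a := mul_pos hk ha
  have hle : φ₁ a ≤ φ₁ 1 := by linarith [hφ.one, mul_nonneg hε.le (hφ.nonneg _ hka)]
  rcases hφ.monotone with ⟨hmono₁, hmono₂⟩ | ⟨hanti₁, hanti₂⟩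
  · have ha1 : a ≤ 1 := (hmono₁.le_iff_le ha (mem_Ioi.2 one_pos)).1 hle
    exact hmono₂ hka hk (mul_le_of_le_one_right hk.le ha1)
  · have ha1 : 1 ≤ a := (hanti₁.le_iff_ge ha (mem_Ioi.2 one_pos)).1 hle
    exact hanti₂ hk hka (le_mul_of_one_le_right hk.le ha1)

variable {ι : Type*} {l : Filter ι} {C : Set ℝ} {ε a k : ι → ℝ}

theorem tendsto_one_of_orlicz_eq
    (hφ : IsOrliczPair φ₁ φ₂) (hC : IsCompact C) (hCpos : C ⊆ Ioi 0)
    (hε : Tendsto ε l (𝓝[>] 0)) (hk : ∀ᶠ i in l, k i ∈ C)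
    (ha : ∀ᶠ i in l, 0 < a i) (heq : ∀ᶠ i in l, φ₁ (a i) + ε i * φ₂ (k i * a i) = 1) :
    Tendsto a l (𝓝 1) := by
  obtain ⟨M, hM⟩ := hC.bddAbove_image (hφ.cont.mono hCpos)
  obtain ⟨hε0, hεpos⟩ := tendsto_nhdsWithin_iff.1 hε
  have hlim : Tendsto (fun i => φ₁ (a i)) l (𝓝 (φ₁ 1)) := by
    rw [hφ.one]
    refine tendsto_of_tendsto_of_tendsto_of_le_of_le'
      (by simpa using (hε0.mul_const M).const_sub 1) tendsto_const_nhds ?_ ?_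
    all_goals
      filter_upwards [hεpos, hk, ha, heq] with i (hεi : 0 < ε i) hki hai heqi
    · have hle := (orlicz_apply_mul_le hφ hεi hai (hCpos hki) heqi).trans
        (hM (mem_image_of_mem φ₂ hki))
      linarith [mul_le_mul_of_nonneg_left hle hεi.le]
    · linarith [mul_nonneg hεi.le (hφ.nonneg _ (mul_pos (hCpos hki) hai))]
  rcases hφ.monotone with ⟨hmono, -⟩ | ⟨hanti, -⟩
  · exact tendsto_of_strictMonoOn hmono (Ioi_mem_nhds one_pos) ha hlim
  · exact tendsto_of_strictAntiOn hanti (Ioi_mem_nhds one_pos) ha hlim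

theorem tendsto_apply_mul_sub_apply {φ : ℝ → ℝ} (hcont : ContinuousOn φ (Ioi 0))
    (hC : IsCompact C) (hCpos : C ⊆ Ioi 0) (hk : ∀ᶠ i in l, k i ∈ C) (ha : Tendsto a l (𝓝 1)) :
    Tendsto (fun i => φ (k i * a i) - φ (k i)) l (𝓝 0) := by
  obtain ⟨M, hM⟩ := hC.isBounded.exists_norm_le
  have hdist : Tendsto (fun i => dist (k i) (k i * a i)) l (𝓝 0) := by
    refine squeeze_zero' (.of_forall fun i => dist_nonneg) ?_
      (by simpa using (tendsto_iff_dist_tendsto_zero.1 ha).const_mul M)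
    filter_upwards [hk] with i hi
    calc dist (k i) (k i * a i) = ‖k i‖ * dist (a i) 1 := by
          rw [dist_comm, Real.dist_eq, Real.dist_eq, Real.norm_eq_abs, ← abs_mul, mul_sub_one]
      _ ≤ M * dist (a i) 1 := by gcongr; exact hM _ hi
  have htendsto : Tendsto (fun i => (k i, k i * a i)) l (uniformity ℝ) :=
    tendsto_uniformity_iff_dist_tendsto_zero.2 hdist
  refine tendsto_zero_iff_norm_tendsto_zero.2 (tendsto_order.2
    ⟨fun y hy => .of_forall fun i => hy.trans_le (norm_nonneg _), fun δ hδ => ?_⟩)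
  have hunif := hC.uniformContinuousAt_of_continuousAt φ
    (fun x hx => hcont.continuousAt (Ioi_mem_nhds (hCpos hx))) (Metric.dist_mem_uniformity hδ)
  filter_upwards [hk, htendsto hunif] with i hki hi
  rw [← dist_eq_norm, dist_comm]
  exact hi hki

theorem tendsto_orlicz_expansion
    (hφ : IsOrliczPair φ₁ φ₂) {d : ℝ} (hderiv : HasDerivAt φ₁ d 1) (hd : d ≠ 0)
    (hC : IsCompact C) (hCpos : C ⊆ Ioi 0) (hε : Tendsto ε l (𝓝[>] 0)) (hk : ∀ᶠ i in l, k i ∈ C)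
    (ha : ∀ᶠ i in l, 0 < a i) (heq : ∀ᶠ i in l, φ₁ (a i) + ε i * φ₂ (k i * a i) = 1) :
    Tendsto (fun i => (1 - a i) / ε i - φ₂ (k i) / d) l (𝓝 0) := by
  have ha1 := tendsto_one_of_orlicz_eq hφ hC hCpos hε hk ha heq
  have hslope : Tendsto (fun i => dslope φ₁ 1 (a i)) l (𝓝 d) := by
    have h1 := (continuousAt_dslope_same.2 hderiv.differentiableAt).tendsto.comp ha1
    rwa [dslope_same, hderiv.deriv] at h1
  obtain ⟨M, hM⟩ := (hC.image_of_continuousOn (hφ.cont.mono hCpos)).isBounded.exists_norm_le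
  have hbdd : IsBoundedUnder (· ≤ ·) l (norm ∘ fun i => φ₂ (k i)) :=
    isBoundedUnder_of_eventually_le (hk.mono fun i hi => hM _ (mem_image_of_mem φ₂ hi))
  have hinv : Tendsto (fun i => (dslope φ₁ 1 (a i))⁻¹ - d⁻¹) l (𝓝 0) := by
    simpa using (hslope.inv₀ hd).sub_const d⁻¹
  have hlim := ((tendsto_apply_mul_sub_apply hφ.cont hC hCpos hk ha1).mul (hslope.inv₀ hd)).add
    (isBoundedUnder_le_mul_tendsto_zero hbdd hinv)
  rw [zero_mul, add_zero] at hlim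
  refine hlim.congr' ?_
  filter_upwards [hslope.eventually_ne hd, heq, (tendsto_nhdsWithin_iff.1 hε).2]
    with i hD heqi (hεi : 0 < ε i)
  have hfactor : (a i - 1) * dslope φ₁ 1 (a i) = -(ε i * φ₂ (k i * a i)) := by
    rw [← smul_eq_mul, sub_smul_dslope, hφ.one]
    linarith
  have hquot : (1 - a i) / ε i = φ₂ (k i * a i) / dslope φ₁ 1 (a i) := by
    rw [div_eq_div_iff hεi.ne' hD]
    linarith
  rw [hquot]
  ring

theorem tendstoUniformlyOn_orlicz_expansion {n : ℕ} {Ω : Set (Sph n)} {h₁ h₂ : Sph n → ℝ}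
    {h : ℝ → Sph n → ℝ} (hφ : IsOrliczPair φ₁ φ₂) {d : ℝ} (hderiv : HasDerivAt φ₁ d 1) (hd : d ≠ 0)
    (hΩ : IsClosed Ω) (hh₁ : IsCPos Ω h₁) (hh₂ : IsCPos Ω h₂)
    (hh : ∀ ε, 0 < ε → IsOrliczCombination Ω φ₁ φ₂ h₁ h₂ ε (h ε)) :
    TendstoUniformlyOn (fun ε u => (1 - h₁ u / h ε u) / ε) (fun u => φ₂ (h₂ u / h₁ u) / d)
      (𝓝[>] 0) Ω := by
  have hquot_pos : (fun u => h₂ u / h₁ u) '' Ω ⊆ Ioi 0 :=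
    image_subset_iff.2 fun u hu => div_pos (hh₂.2 u hu) (hh₁.2 u hu)
  have hquot_compact : IsCompact ((fun u => h₂ u / h₁ u) '' Ω) :=
    hΩ.isCompact.image_of_continuousOn (hh₂.1.div hh₁.1 fun u hu => (hh₁.2 u hu).ne')
  have hmem : ∀ᶠ p : ℝ × Sph n in 𝓝[>] 0 ×ˢ 𝓟 Ω, 0 < p.1 ∧ p.2 ∈ Ω :=
    prod_mem_prod self_mem_nhdsWithin (mem_principal_self Ω)
  have hlim := tendsto_orlicz_expansion (ε := fun p : ℝ × Sph n => p.1)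
    (a := fun p => h₁ p.2 / h p.1 p.2) (k := fun p => h₂ p.2 / h₁ p.2) hφ hderiv hd
    hquot_compact hquot_pos tendsto_fst (hmem.mono fun p hp => mem_image_of_mem _ hp.2)
    (hmem.mono fun p hp => div_pos (hh₁.2 _ hp.2) (hh p.1 hp.1 _ hp.2).1) <| by
      filter_upwards [hmem] with p hp
      rw [div_mul_div_cancel₀ (hh₁.2 _ hp.2).ne']
      exact (hh p.1 hp.1 _ hp.2).2
  rw [tendstoUniformlyOn_iff_tendsto, tendsto_uniformity_iff_dist_tendsto_zero]
  refine (tendsto_zero_iff_norm_tendsto_zero.1 hlim).congr fun p => ?_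
  rw [dist_comm, dist_eq_norm]

end OrliczExpansion

section ConvexBodies

section NormedSpace

variable {E : Type*} [NormedAddCommGroup E] [NormedSpace ℝ E] {K : Set E} {x : E}

/-- A convex body containing the origin in its interior, that is, a member of the class
`𝒦ⁿ₍ₒ₎` when `E = ℝⁿ`. -/
structure IsOriginBody (K : Set E) : Prop where
  convex : Convex ℝ K
  isCompact : IsCompact K
  mem_nhds_zero : K ∈ 𝓝 0

namespace IsOriginBody

theorem gauge_pos (hK : IsOriginBody K) (hx : x ≠ 0) : 0 < gauge K x :=
  (_root_.gauge_pos (absorbent_nhds_zero hK.mem_nhds_zero)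
    (NormedSpace.isVonNBounded_of_isBounded ℝ hK.isCompact.isBounded)).2 hx

theorem gauge_le_one_iff (hK : IsOriginBody K) : gauge K x ≤ 1 ↔ x ∈ K := by
  rw [gauge_le_one_iff_mem_closure hK.convex hK.mem_nhds_zero, hK.isCompact.isClosed.closure_eq]

theorem inv_gauge_smul_mem (hK : IsOriginBody K) (hx : x ≠ 0) : (gauge K x)⁻¹ • x ∈ K := by
  rw [← hK.gauge_le_one_iff, gauge_smul_of_nonneg (inv_nonneg.2 (gauge_nonneg x)), smul_eq_mul,
    inv_mul_cancel₀ (hK.gauge_pos hx).ne']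

theorem continuous_gauge (hK : IsOriginBody K) : Continuous (gauge K) :=
  _root_.continuous_gauge hK.convex hK.mem_nhds_zero

end IsOriginBody

end NormedSpace

section Sphere

variable {n : ℕ} {K : Set (EuclideanSpace ℝ (Fin n))} {u v : Sph n}

namespace IsOriginBody

theorem gauge_coe_pos (hK : IsOriginBody K) (v : Sph n) : 0 < gauge K v :=
  hK.gauge_pos (ne_zero_of_mem_unit_sphere v)

theorem radialFn_eq (hK : IsOriginBody K) (v : Sph n) : radialFn K v = (gauge K v)⁻¹ := by
  have hset : {r : ℝ | 0 < r ∧ r • (v : EuclideanSpace ℝ (Fin n)) ∈ K} =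
      Ioc 0 (gauge K v)⁻¹ := by
    ext r
    refine and_congr_right fun hr => ?_
    rw [← hK.gauge_le_one_iff, gauge_smul_of_nonneg hr.le, smul_eq_mul,
      ← le_div_iff₀ (hK.gauge_coe_pos v), one_div]
  rw [radialFn, hset, csSup_Ioc (inv_pos.2 (hK.gauge_coe_pos v))]

theorem radialFn_pos (hK : IsOriginBody K) (v : Sph n) : 0 < radialFn K v := by
  rw [hK.radialFn_eq]
  exact inv_pos.2 (hK.gauge_coe_pos v)

theorem continuous_radialFn (hK : IsOriginBody K) : Continuous (radialFn K) := by
  simp only [funext hK.radialFn_eq]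
  exact (hK.continuous_gauge.comp continuous_subtype_val).inv₀ fun v => (hK.gauge_coe_pos v).ne'

theorem inner_le_supportFn_mul_gauge (hK : IsOriginBody K) (x : EuclideanSpace ℝ (Fin n))
    (u : Sph n) : ⟪x, (u : EuclideanSpace ℝ (Fin n))⟫ ≤ supportFn K u * gauge K x := by
  rcases eq_or_ne x 0 with rfl | hx
  · simp
  have hbdd : BddAbove ((fun y => ⟪(u : EuclideanSpace ℝ (Fin n)), y⟫) '' K) :=
    hK.isCompact.bddAbove_image (by fun_prop)
  have hle := le_csSup hbdd (mem_image_of_mem _ (hK.inv_gauge_smul_mem hx))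
  rwa [real_inner_smul_right, real_inner_comm, inv_mul_le_iff₀ (hK.gauge_pos hx), mul_comm] at hle

theorem supportFn_pos (hK : IsOriginBody K) (u : Sph n) : 0 < supportFn K u := by
  have hle := hK.inner_le_supportFn_mul_gauge u u
  rw [real_inner_self_eq_norm_sq, norm_eq_of_mem_sphere, one_pow] at hle
  exact pos_of_mul_pos_left (one_pos.trans_le hle) (gauge_nonneg _)

theorem mem_reverseRadialGaussImage_iff_exists (hK : IsOriginBody K) {E : Set (Sph n)} :
    v ∈ reverseRadialGaussImage K E ↔
      ∃ u ∈ E, ⟪(v : EuclideanSpace ℝ (Fin n)), u⟫ = supportFn K u * gauge K v := by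
  refine exists_congr fun u => and_congr_right fun _ => ⟨?_, fun huv => ?_⟩
  · rintro ⟨x, ⟨hx_frontier, hx_support⟩, hvx⟩
    have hx : gauge K x = 1 :=
      (gauge_eq_one_iff_mem_frontier hK.convex hK.mem_nhds_zero).2 hx_frontier
    rw [hvx, real_inner_smul_left, hx_support.out,
      gauge_smul_of_nonneg (inv_nonneg.2 (norm_nonneg x)), hx, smul_eq_mul, mul_one, mul_comm]
  · have hgauge := hK.gauge_coe_pos v
    refine ⟨(gauge K v)⁻¹ • v, ⟨?_, ?_⟩, ?_⟩
    · rw [← gauge_eq_one_iff_mem_frontier hK.convex hK.mem_nhds_zero,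
        gauge_smul_of_nonneg (inv_nonneg.2 hgauge.le), smul_eq_mul, inv_mul_cancel₀ hgauge.ne']
    · rw [supportingHyperplane, mem_ofPred_eq, real_inner_smul_left, huv]
      field_simp
    · rw [norm_smul, norm_eq_of_mem_sphere, mul_one, norm_inv, Real.norm_of_nonneg hgauge.le,
        inv_inv, smul_smul, mul_inv_cancel₀ hgauge.ne', one_smul]

end IsOriginBody

end Sphere

end ConvexBodies

section Gradient

open scoped Gradient

section HilbertSpace

variable {E : Type*} [NormedAddCommGroup E] [InnerProductSpace ℝ E] [CompleteSpace E]

theorem gradient_eq_of_isSubgradient {M : E → ℝ} {x p : E} (hM : DifferentiableAt ℝ M x)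
    (hle : ∀ y, ⟪y, p⟫ ≤ M y) (heq : ⟪x, p⟫ = M x) : ∇ M x = p := by
  have hmin : IsLocalMin (fun y => M y - innerSL ℝ p y) x :=
    .of_forall fun y => by
      simp only [innerSL_apply_apply, real_inner_comm _ p, heq, sub_self]
      exact sub_nonneg.2 (hle y)
  have hderiv := hmin.hasFDerivAt_eq_zero (hM.hasFDerivAt.sub (innerSL ℝ p).hasFDerivAt)
  refine HasGradientAt.gradient (hasGradientAt_iff_hasFDerivAt.2 ?_)
  exact sub_eq_zero.1 hderiv ▸ hM.hasFDerivAt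

theorem inner_gradient_le_of_subadditive {M : E → ℝ} {x : E} (hM : DifferentiableAt ℝ M x)
    (hadd : ∀ y z, M (y + z) ≤ M y + M z) (hsmul : ∀ r : ℝ, 0 < r → ∀ y, M (r • y) = r * M y)
    (y : E) : ⟪∇ M x, y⟫ ≤ M y := by
  rw [inner_gradient_left]
  refine le_of_tendsto (hM.hasFDerivAt.hasLineDerivAt y).tendsto_slope_zero_right ?_
  filter_upwards [self_mem_nhdsWithin] with t (ht : 0 < t)
  rw [smul_eq_mul, inv_mul_le_iff₀ ht, ← hsmul t ht]
  linarith [hadd x (t • y)]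

theorem inner_gradient_self_of_posHomogeneous {M : E → ℝ} {x : E} (hM : DifferentiableAt ℝ M x)
    (hsmul : ∀ r : ℝ, 0 < r → ∀ y, M (r • y) = r * M y) : ⟪∇ M x, x⟫ = M x := by
  rw [inner_gradient_left]
  refine tendsto_nhds_unique (hM.hasFDerivAt.hasLineDerivAt x).tendsto_slope_zero_right
    (tendsto_const_nhds.congr' ?_)
  filter_upwards [self_mem_nhdsWithin] with t (ht : 0 < t)
  have hray : x + t • x = (1 + t) • x := by rw [add_smul, one_smul]
  rw [hray, hsmul (1 + t) (by positivity), smul_eq_mul]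
  field_simp
  ring

theorem measurable_gradient [MeasurableSpace E] [BorelSpace E] (M : E → ℝ) :
    Measurable (∇ M) :=
  (InnerProductSpace.toDual ℝ E).symm.continuous.measurable.comp (measurable_fderiv ℝ M)

end HilbertSpace

section Sphere

variable {n : ℕ} {K : Set (EuclideanSpace ℝ (Fin n))} {v : Sph n}

open Classical in
/-- The radial Gauss map `α_K`: it sends `v` to the outer unit normal of `K` at the boundary
point in direction `v`, which is the normalized gradient of the gauge. Directions in which the
gauge has no nonzero gradient form a null set, and there the value is `v`. -/
def radialGaussMap (K : Set (EuclideanSpace ℝ (Fin n))) (v : Sph n) : Sph n :=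
  ⟨NormedSpace.normalize (if ∇ (gauge K) v = 0 then (v : EuclideanSpace ℝ (Fin n))
    else ∇ (gauge K) v), by
    rw [mem_sphere_zero_iff_norm, NormedSpace.norm_normalize_eq_one_iff]
    split_ifs with h
    exacts [ne_zero_of_mem_unit_sphere v, h]⟩

theorem coe_radialGaussMap (h : ∇ (gauge K) v ≠ 0) :
    (radialGaussMap K v : EuclideanSpace ℝ (Fin n)) = NormedSpace.normalize (∇ (gauge K) v) := by
  simp only [radialGaussMap, if_neg h]

open Classical in
theorem measurable_radialGaussMap (K : Set (EuclideanSpace ℝ (Fin n))) :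
    Measurable (radialGaussMap K) := by
  have hgrad : Measurable fun v : Sph n => ∇ (gauge K) (v : EuclideanSpace ℝ (Fin n)) :=
    (measurable_gradient _).comp measurable_subtype_coe
  have hite : Measurable fun v : Sph n => if ∇ (gauge K) v = 0
      then (v : EuclideanSpace ℝ (Fin n)) else ∇ (gauge K) v :=
    .ite (hgrad (measurableSet_singleton 0)) measurable_subtype_coe hgrad
  exact (hite.norm.inv.smul hite).subtype_mk

theorem inner_gradient_gauge_self (hv : DifferentiableAt ℝ (gauge K) v) :
    ⟪∇ (gauge K) v, (v : EuclideanSpace ℝ (Fin n))⟫ = gauge K v :=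
  inner_gradient_self_of_posHomogeneous hv fun _ hr y => gauge_smul_of_nonneg hr.le y

namespace IsOriginBody

theorem gradient_gauge_ne_zero (hK : IsOriginBody K) (hv : DifferentiableAt ℝ (gauge K) v) :
    ∇ (gauge K) v ≠ 0 := by
  intro h
  have hself := inner_gradient_gauge_self hv
  rw [h, inner_zero_left] at hself
  exact (hK.gauge_coe_pos v).ne hself

theorem radialGaussMap_eq (hK : IsOriginBody K) (hv : DifferentiableAt ℝ (gauge K) v)
    {u : Sph n} {a : ℝ} (ha : 0 < a)
    (hle : ∀ y, ⟪y, (u : EuclideanSpace ℝ (Fin n))⟫ ≤ a * gauge K y)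
    (heq : ⟪(v : EuclideanSpace ℝ (Fin n)), u⟫ = a * gauge K v) : radialGaussMap K v = u := by
  have hgrad : ∇ (gauge K) v = a⁻¹ • (u : EuclideanSpace ℝ (Fin n)) := by
    refine gradient_eq_of_isSubgradient hv (fun y => ?_) ?_
    · rw [real_inner_smul_right, inv_mul_le_iff₀ ha]
      exact hle y
    · rw [real_inner_smul_right, heq, inv_mul_cancel_left₀ ha.ne']
  refine Subtype.ext ?_
  rw [coe_radialGaussMap (hK.gradient_gauge_ne_zero hv), hgrad,
    NormedSpace.normalize_smul_of_pos (inv_pos.2 ha),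
    NormedSpace.normalize_eq_self_of_norm_eq_one (norm_eq_of_mem_sphere u)]

theorem supportFn_radialGaussMap_mul_gauge (hK : IsOriginBody K)
    (hv : DifferentiableAt ℝ (gauge K) v) :
    supportFn K (radialGaussMap K v) * gauge K v =
      ⟪(v : EuclideanSpace ℝ (Fin n)), radialGaussMap K v⟫ := by
  refine (hK.inner_le_supportFn_mul_gauge _ _).antisymm' ?_
  set p := ∇ (gauge K) v
  have hp : 0 < ‖p‖⁻¹ := inv_pos.2 (norm_pos_iff.2 (hK.gradient_gauge_ne_zero hv))
  have hinner : ∀ y, ⟪(radialGaussMap K v : EuclideanSpace ℝ (Fin n)), y⟫ = ‖p‖⁻¹ * ⟪p, y⟫ :=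
    fun y => by
      rw [coe_radialGaussMap (hK.gradient_gauge_ne_zero hv), ← real_inner_smul_left]
      rfl
  have hsupport : supportFn K (radialGaussMap K v) ≤ ‖p‖⁻¹ := by
    refine csSup_le (Set.Nonempty.image _ ⟨0, mem_of_mem_nhds hK.mem_nhds_zero⟩) ?_
    rintro _ ⟨y, hy, rfl⟩
    refine (hinner y).trans_le (mul_le_of_le_one_right hp.le ?_)
    exact (inner_gradient_le_of_subadditive hv
      (gauge_add_le hK.convex (absorbent_nhds_zero hK.mem_nhds_zero))
      (fun _ hr y => gauge_smul_of_nonneg hr.le y) y).trans (hK.gauge_le_one_iff.2 hy)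
  rw [real_inner_comm, hinner, inner_gradient_gauge_self hv]
  exact mul_le_mul_of_nonneg_right hsupport (gauge_nonneg _)

theorem mem_reverseRadialGaussImage_iff (hK : IsOriginBody K)
    (hv : DifferentiableAt ℝ (gauge K) v) {E : Set (Sph n)} :
    v ∈ reverseRadialGaussImage K E ↔ radialGaussMap K v ∈ E := by
  rw [hK.mem_reverseRadialGaussImage_iff_exists]
  refine ⟨?_, fun h => ⟨_, h, (hK.supportFn_radialGaussMap_mul_gauge hv).symm⟩⟩
  rintro ⟨u, hu, huv⟩
  rwa [hK.radialGaussMap_eq hv (hK.supportFn_pos u) (hK.inner_le_supportFn_mul_gauge · u) huv]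

end IsOriginBody

end Sphere

end Gradient

section SignedMeasures

variable {X Y : Type*} [MeasurableSpace X] [MeasurableSpace Y] {μ : Measure X} {f g : X → ℝ}
  {C : ℝ}

theorem integral_toSignedMeasure_real (ν : Measure X) [IsFiniteMeasure ν] (g : X → ℝ) :
    ∫ᵛ x, g x ∂•ν.toSignedMeasure = ∫ x, g x ∂ν := by
  have hflip : (ContinuousLinearMap.lsmul ℝ ℝ : ℝ →L[ℝ] ℝ →L[ℝ] ℝ) =
      (ContinuousLinearMap.lsmul ℝ ℝ).flip := by
    ext
    simp
  rw [hflip, VectorMeasure.integral_toSignedMeasure]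

theorem integral_withDensity_ofReal (hf : AEMeasurable f μ) (g : X → ℝ) :
    ∫ x, g x ∂(μ.withDensity fun x => ENNReal.ofReal (f x)) = ∫ x, g x * max (f x) 0 ∂μ := by
  rw [integral_withDensity_eq_integral_toReal_smul₀ hf.ennreal_ofReal
    (ae_of_all _ fun x => ENNReal.ofReal_lt_top)]
  simp only [ENNReal.toReal_ofReal', smul_eq_mul, mul_comm]

theorem integral_withDensityᵥ_eq (hf : Integrable f μ) (hg : AEStronglyMeasurable g μ)
    (hgC : ∀ᵐ x ∂μ, ‖g x‖ ≤ C) :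
    ∫ᵛ x, g x ∂•(μ.withDensityᵥ f) = ∫ x, g x * f x ∂μ := by
  have hneg : Integrable (fun x => -f x) μ := hf.neg
  have := isFiniteMeasure_withDensity_ofReal hf.2
  have := isFiniteMeasure_withDensity_ofReal hneg.2
  have hint : ∀ (k : X → ℝ) [IsFiniteMeasure (μ.withDensity fun x => ENNReal.ofReal (k x))],
      (μ.withDensity fun x => ENNReal.ofReal (k x)).toSignedMeasure.Integrable g := fun k _ => by
    rw [VectorMeasure.Integrable, Measure.variation_toSignedMeasure]
    have hac := withDensity_absolutelyContinuous μ fun x => ENNReal.ofReal (k x)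
    exact Integrable.of_bound (hg.mono_ac hac) C (hac.ae_le hgC)
  rw [withDensityᵥ_eq_withDensity_pos_part_sub_withDensity_neg_part hf,
    VectorMeasure.integral_sub_vectorMeasure (hint _) (hint _),
    integral_toSignedMeasure_real, integral_toSignedMeasure_real,
    integral_withDensity_ofReal hf.aemeasurable, integral_withDensity_ofReal hneg.aemeasurable,
    ← integral_sub (hf.pos_part.bdd_mul hg hgC) (hneg.pos_part.bdd_mul hg hgC)]
  simp only [← mul_sub, max_zero_sub_max_neg_zero_eq_self]

theorem restrict_withDensityᵥ (hf : Integrable f μ) {s : Set X} (hs : MeasurableSet s) :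
    (μ.withDensityᵥ f).restrict s = (μ.restrict s).withDensityᵥ f := by
  ext t ht
  rw [VectorMeasure.restrict_apply _ hs ht, withDensityᵥ_apply hf (ht.inter hs),
    withDensityᵥ_apply hf.restrict ht, Measure.restrict_restrict ht]

theorem integral_map_withDensityᵥ (hf : Integrable f μ) {T : X → Y} (hT : Measurable T)
    {ψ : Y → ℝ} (hψ : AEStronglyMeasurable ψ (μ.map T)) (hψC : ∀ᵐ x ∂μ, ‖ψ (T x)‖ ≤ C) :
    ∫ᵛ y, ψ y ∂•((μ.withDensityᵥ f).map T) = ∫ x, ψ (T x) * f x ∂μ := by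
  have hvar : (μ.withDensityᵥ f).variation = μ.withDensity fun x => ‖f x‖ₑ :=
    Measure.variation_withDensityᵥ hf
  have hac : (μ.withDensityᵥ f).variation ≪ μ := hvar ▸ withDensity_absolutelyContinuous _ _
  have : IsFiniteMeasure (μ.withDensityᵥ f).variation :=
    hvar ▸ isFiniteMeasure_withDensity hf.2.ne
  have hψT : AEStronglyMeasurable (fun x => ψ (T x)) μ := hψ.comp_measurable hT
  rw [VectorMeasure.integral_map hT (hψ.mono_ac (hac.map hT))
    (Integrable.of_bound (hψT.mono_ac hac) C (hac.ae_le hψC)), integral_withDensityᵥ_eq hf hψT hψC]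

theorem setIntegral_map_withDensityᵥ (hf : Integrable f μ) {T : X → Y} (hT : Measurable T)
    {s : Set Y} (hs : MeasurableSet s) {ψ : Y → ℝ}
    (hψ : AEStronglyMeasurable ψ ((μ.map T).restrict s)) (hψC : ∀ y ∈ s, ‖ψ y‖ ≤ C) :
    ∫ᵛ y in s, ψ y ∂•((μ.withDensityᵥ f).map T) = ∫ x in T ⁻¹' s, ψ (T x) * f x ∂μ := by
  rw [VectorMeasure.restrict_map _ hT hs, restrict_withDensityᵥ hf (hT hs)]
  rw [Measure.restrict_map hT hs] at hψ
  exact integral_map_withDensityᵥ hf.restrict hT hψ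
    ((ae_restrict_mem (hT hs)).mono fun x hx => hψC _ hx)

end SignedMeasures

section DualCurvature

variable {n : ℕ} {K : Set (EuclideanSpace ℝ (Fin n))} {G : ℝ → Sph n → ℝ}

theorem differentiableAt_gauge_of_smul {E : Type*} [NormedAddCommGroup E] [NormedSpace ℝ E]
    {K : Set E} {x : E} {r : ℝ} (hr : 0 < r) (hd : DifferentiableAt ℝ (gauge K) (r • x)) :
    DifferentiableAt ℝ (gauge K) x := by
  have hgauge : gauge K = fun y => r⁻¹ * gauge K (r • y) := by
    ext y
    rw [gauge_smul_of_nonneg hr.le, smul_eq_mul, inv_mul_cancel_left₀ hr.ne']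
  rw [hgauge]
  exact (DifferentiableAt.comp (𝕜 := ℝ) x hd (differentiableAt_id.const_smul r)).const_mul _

/-- The density `ρ_K(v) G_t(ρ_K(v), v)` of `n C̃_G(K, ·)`, pulled back to radial directions. -/
def dualCurvatureDensity (G : ℝ → Sph n → ℝ) (K : Set (EuclideanSpace ℝ (Fin n))) (v : Sph n) :
    ℝ :=
  radialFn K v * partialT G (radialFn K v) v

namespace IsOriginBody

theorem ae_differentiableAt_gauge (hK : IsOriginBody K) :
    ∀ᵐ v : Sph n ∂(sphMeasure n), DifferentiableAt ℝ (gauge K) v := by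
  obtain ⟨L, hlip⟩ := hK.convex.lipschitz_gauge hK.mem_nhds_zero
  have hmeas : MeasurableSet {v : Sph n | ¬ DifferentiableAt ℝ (gauge K) v} :=
    (measurable_subtype_coe (measurableSet_of_differentiableAt ℝ (gauge K))).compl
  rw [ae_iff, Measure.toSphere_apply' _ hmeas]
  refine mul_eq_zero_of_right _ (measure_mono_null ?_ (ae_iff.1 hlip.ae_differentiableAt))
  rintro _ ⟨r, hr, _, ⟨v, hv, rfl⟩, rfl⟩ hd
  exact hv (differentiableAt_gauge_of_smul hr.1 hd)

theorem reverseRadialGaussImage_ae_eq (hK : IsOriginBody K) (E : Set (Sph n)) :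
    reverseRadialGaussImage K E =ᵐ[sphMeasure n] radialGaussMap K ⁻¹' E := by
  filter_upwards [hK.ae_differentiableAt_gauge] with v hv
  exact propext (hK.mem_reverseRadialGaussImage_iff hv)

theorem nullMeasurableSet_reverseRadialGaussImage (hK : IsOriginBody K) {E : Set (Sph n)}
    (hE : MeasurableSet E) : NullMeasurableSet (reverseRadialGaussImage K E) (sphMeasure n) :=
  (measurable_radialGaussMap K hE).nullMeasurableSet.congr (hK.reverseRadialGaussImage_ae_eq E).symm

theorem continuous_dualCurvatureDensity (hK : IsOriginBody K)
    (hGt : ContinuousOn (fun p : ℝ × Sph n => partialT G p.1 p.2) (Ioi 0 ×ˢ univ)) :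
    Continuous (dualCurvatureDensity G K) :=
  hK.continuous_radialFn.mul (hGt.comp_continuous (hK.continuous_radialFn.prodMk continuous_id)
    fun v => ⟨hK.radialFn_pos v, mem_univ v⟩)

theorem integrable_dualCurvatureDensity (hK : IsOriginBody K)
    (hGt : ContinuousOn (fun p : ℝ × Sph n => partialT G p.1 p.2) (Ioi 0 ×ˢ univ)) :
    Integrable (dualCurvatureDensity G K) (sphMeasure n) :=
  (hK.continuous_dualCurvatureDensity hGt).integrable_of_hasCompactSupport
    (.of_compactSpace _)

theorem map_radialGaussMap_apply (hK : IsOriginBody K)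
    (hGt : ContinuousOn (fun p : ℝ × Sph n => partialT G p.1 p.2) (Ioi 0 ×ˢ univ))
    {E : Set (Sph n)} (hE : MeasurableSet E) :
    ((sphMeasure n).withDensityᵥ fun v => 1 / (n : ℝ) * dualCurvatureDensity G K v).map
      (radialGaussMap K) E = dualCurvatureSetFn G K E := by
  have hT := measurable_radialGaussMap K
  rw [VectorMeasure.map_apply _ hT hE,
    withDensityᵥ_apply ((hK.integrable_dualCurvatureDensity hGt).const_mul _) (hT hE),
    integral_const_mul, ← setIntegral_congr_set (hK.reverseRadialGaussImage_ae_eq E)]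
  rfl

theorem dualCurvatureMeasure_apply (hK : IsOriginBody K)
    (hGt : ContinuousOn (fun p : ℝ × Sph n => partialT G p.1 p.2) (Ioi 0 ×ˢ univ))
    {E : Set (Sph n)} (hE : MeasurableSet E) :
    dualCurvatureMeasure G K E = dualCurvatureSetFn G K E := by
  have hex : ∃ μ : SignedMeasure (Sph n), ∀ E, MeasurableSet E → μ E = dualCurvatureSetFn G K E :=
    ⟨_, fun _ => hK.map_radialGaussMap_apply hGt⟩
  rw [dualCurvatureMeasure, dif_pos hex]
  exact hex.choose_spec E hE

theorem dualCurvatureMeasure_eq_map (hK : IsOriginBody K)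
    (hGt : ContinuousOn (fun p : ℝ × Sph n => partialT G p.1 p.2) (Ioi 0 ×ˢ univ)) :
    dualCurvatureMeasure G K =
      ((sphMeasure n).withDensityᵥ fun v => 1 / (n : ℝ) * dualCurvatureDensity G K v).map
        (radialGaussMap K) := by
  ext E hE
  rw [hK.dualCurvatureMeasure_apply hGt hE, hK.map_radialGaussMap_apply hGt hE]

theorem setIntegral_dualCurvatureMeasure (hK : IsOriginBody K)
    (hGt : ContinuousOn (fun p : ℝ × Sph n => partialT G p.1 p.2) (Ioi 0 ×ˢ univ))
    {Ω : Set (Sph n)} (hΩ : IsClosed Ω) {ψ : Sph n → ℝ} (hψ : ContinuousOn ψ Ω) :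
    ∫ᵛ u in Ω, ψ u ∂•(dualCurvatureMeasure G K) = 1 / (n : ℝ) *
      ∫ v in radialGaussMap K ⁻¹' Ω, ψ (radialGaussMap K v) * dualCurvatureDensity G K v
        ∂(sphMeasure n) := by
  obtain ⟨C, hC⟩ := hΩ.isCompact.exists_bound_of_continuousOn hψ
  rw [hK.dualCurvatureMeasure_eq_map hGt,
    setIntegral_map_withDensityᵥ ((hK.integrable_dualCurvatureDensity hGt).const_mul _)
      (measurable_radialGaussMap K) hΩ.measurableSet
      (hψ.aestronglyMeasurable hΩ.measurableSet) hC, ← integral_const_mul]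
  simp only [mul_left_comm]

end IsOriginBody

end DualCurvature

section AleksandrovBodies

open scoped Pointwise

variable {n : ℕ} {Ω : Set (Sph n)} {h k : Sph n → ℝ} {c : ℝ} {v w : Sph n}

theorem IsCPos.exists_lower_bound (hΩ : IsClosed Ω) (hh : IsCPos Ω h) :
    ∃ c, 0 < c ∧ ∀ w ∈ Ω, c ≤ h w :=
  hΩ.isCompact.exists_forall_le' hh.1 hh.2

theorem mem_aleksandrovBody {x : EuclideanSpace ℝ (Fin n)} :
    x ∈ aleksandrovBody Ω h ↔ ∀ w ∈ Ω, ⟪x, (w : EuclideanSpace ℝ (Fin n))⟫ ≤ h w := by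
  simp only [aleksandrovBody, mem_iInter, mem_ofPred_eq]

theorem convex_aleksandrovBody : Convex ℝ (aleksandrovBody Ω h) :=
  convex_iInter₂ fun w _ => convex_halfSpace_le
    ⟨fun x y => inner_add_left x y _, fun r x => real_inner_smul_left x _ r⟩ (h w)

theorem isClosed_aleksandrovBody : IsClosed (aleksandrovBody Ω h) :=
  isClosed_biInter fun _ _ => isClosed_le (by fun_prop) continuous_const

theorem aleksandrovBody_mem_nhds_zero (hc : 0 < c) (hh : ∀ w ∈ Ω, c ≤ h w) :
    aleksandrovBody Ω h ∈ 𝓝 0 := by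
  filter_upwards [Metric.closedBall_mem_nhds (0 : EuclideanSpace ℝ (Fin n)) hc] with x hx
  refine mem_aleksandrovBody.2 fun w hw => (real_inner_le_norm x w).trans ?_
  rw [norm_eq_of_mem_sphere, mul_one]
  exact (mem_closedBall_zero_iff.1 hx).trans (hh w hw)

theorem inner_le_mul_gauge_aleksandrovBody (hbody : aleksandrovBody Ω h ∈ 𝓝 0) (hw : w ∈ Ω)
    (hpos : 0 < h w) (x : EuclideanSpace ℝ (Fin n)) :
    ⟪x, (w : EuclideanSpace ℝ (Fin n))⟫ ≤ h w * gauge (aleksandrovBody Ω h) x := by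
  rw [← div_le_iff₀' hpos]
  refine le_of_forall_gt fun b hb => ?_
  obtain ⟨r, hr, hrb, y, hy, rfl⟩ := exists_lt_of_gauge_lt (absorbent_nhds_zero hbody) hb
  refine lt_of_le_of_lt ?_ hrb
  simp only [real_inner_smul_left]
  rw [div_le_iff₀ hpos]
  exact mul_le_mul_of_nonneg_left (mem_aleksandrovBody.1 hy w hw) hr.le

theorem IsAdmissibleDomain.exists_inner_pos (hΩ : IsAdmissibleDomain Ω) (v : Sph n) :
    ∃ w ∈ Ω, 0 < ⟪(v : EuclideanSpace ℝ (Fin n)), (w : EuclideanSpace ℝ (Fin n))⟫ := by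
  obtain ⟨w, hw, hwv⟩ := not_subset.1 (hΩ.2 (-v))
  refine ⟨w, hw, ?_⟩
  rw [real_inner_comm]
  simpa using hwv

theorem IsAdmissibleDomain.nonempty (hΩ : IsAdmissibleDomain Ω) (v : Sph n) : Ω.Nonempty :=
  (hΩ.exists_inner_pos v).imp fun _ => And.left

theorem isOriginBody_aleksandrovBody (hΩ : IsAdmissibleDomain Ω) (hc : 0 < c)
    (hh : ∀ w ∈ Ω, c ≤ h w) : IsOriginBody (aleksandrovBody Ω h) := by
  set K := aleksandrovBody Ω h
  have hK0 : K ∈ 𝓝 0 := aleksandrovBody_mem_nhds_zero hc hh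
  have hgauge_pos (v : EuclideanSpace ℝ (Fin n)) (hv : v ∈ Metric.sphere 0 1) : 0 < gauge K v := by
    obtain ⟨w, hw, hvw⟩ := hΩ.exists_inner_pos ⟨v, hv⟩
    have hpos : 0 < h w := hc.trans_le (hh w hw)
    exact pos_of_mul_pos_right (hvw.trans_le (inner_le_mul_gauge_aleksandrovBody hK0 hw hpos v))
      hpos.le
  obtain ⟨m, hm, hgauge⟩ := (isCompact_sphere 0 1).exists_forall_le'
    (continuous_gauge convex_aleksandrovBody hK0).continuousOn hgauge_pos
  have hbound (x) (hx : x ∈ K) : ‖x‖ ≤ m⁻¹ := by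
    rcases eq_or_ne x 0 with rfl | hx0
    · simpa using hm.le
    have hnorm : 0 < ‖x‖ := norm_pos_iff.2 hx0
    have hle := hgauge (‖x‖⁻¹ • x) (by
      rw [mem_sphere_zero_iff_norm, norm_smul, norm_inv, norm_norm, inv_mul_cancel₀ hnorm.ne'])
    rw [gauge_smul_of_nonneg (inv_nonneg.2 hnorm.le), smul_eq_mul, le_inv_mul_iff₀ hnorm] at hle
    rw [← one_div, le_div_iff₀ hm]
    exact hle.trans (gauge_le_one_of_mem hx)
  exact ⟨convex_aleksandrovBody, Metric.isCompact_of_isClosed_isBounded isClosed_aleksandrovBody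
    (isBounded_iff_forall_norm_le.2 ⟨m⁻¹, hbound⟩), hK0⟩

theorem bddAbove_range_inner_div (hbody : aleksandrovBody Ω h ∈ 𝓝 0) (hh : ∀ w ∈ Ω, 0 < h w)
    (x : EuclideanSpace ℝ (Fin n)) :
    BddAbove (range fun w : Ω => ⟪x, ((w : Sph n) : EuclideanSpace ℝ (Fin n))⟫ / h w) :=
  ⟨gauge (aleksandrovBody Ω h) x, forall_mem_range.2 fun w =>
    (div_le_iff₀' (hh w w.2)).2 (inner_le_mul_gauge_aleksandrovBody hbody w.2 (hh w w.2) x)⟩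

theorem gauge_aleksandrovBody (hΩ : IsAdmissibleDomain Ω) (hbody : aleksandrovBody Ω h ∈ 𝓝 0)
    (hh : ∀ w ∈ Ω, 0 < h w) (v : Sph n) :
    gauge (aleksandrovBody Ω h) v =
      ⨆ w : Ω, ⟪(v : EuclideanSpace ℝ (Fin n)), (w : Sph n)⟫ / h w := by
  have : Nonempty Ω := (hΩ.nonempty v).to_subtype
  have hle := le_ciSup (bddAbove_range_inner_div hbody hh v)
  refine le_antisymm ?_ (ciSup_le fun w => (div_le_iff₀' (hh w w.2)).2
    (inner_le_mul_gauge_aleksandrovBody hbody w.2 (hh w w.2) v))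
  set S := ⨆ w : Ω, ⟪(v : EuclideanSpace ℝ (Fin n)), (w : Sph n)⟫ / h w
  have hS : 0 < S := by
    obtain ⟨w, hw, hvw⟩ := hΩ.exists_inner_pos v
    exact (div_pos hvw (hh w hw)).trans_le (hle ⟨w, hw⟩)
  refine gauge_le_of_mem hS.le ((mem_smul_set_iff_inv_smul_mem₀ hS.ne' _ _).2 ?_)
  refine mem_aleksandrovBody.2 fun w hw => ?_
  rw [real_inner_smul_left, inv_mul_le_iff₀ hS, ← div_le_iff₀ (hh w hw)]
  exact hle ⟨w, hw⟩

theorem radialGaussMap_eq_of_isMaxOn (hΩ : IsAdmissibleDomain Ω)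
    (hbody : IsOriginBody (aleksandrovBody Ω h)) (hh : ∀ w ∈ Ω, 0 < h w)
    (hv : DifferentiableAt ℝ (gauge (aleksandrovBody Ω h)) v) (hw : w ∈ Ω)
    (hmax : IsMaxOn (fun w : Sph n => ⟪(v : EuclideanSpace ℝ (Fin n)), w⟫ / h w) Ω w) :
    radialGaussMap (aleksandrovBody Ω h) v = w := by
  refine hbody.radialGaussMap_eq hv (hh w hw)
    (inner_le_mul_gauge_aleksandrovBody hbody.mem_nhds_zero hw (hh w hw)) ?_
  rw [gauge_aleksandrovBody hΩ hbody.mem_nhds_zero hh, hmax.iSup_eq hw,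
    mul_div_cancel₀ _ (hh w hw).ne']

theorem continuousOn_inner_div (hh : IsCPos Ω h) (x : EuclideanSpace ℝ (Fin n)) :
    ContinuousOn (fun w : Sph n => ⟪x, (w : EuclideanSpace ℝ (Fin n))⟫ / h w) Ω :=
  ContinuousOn.div (by fun_prop) hh.1 fun w hw => (hh.2 w hw).ne'

theorem IsAdmissibleDomain.isOriginBody (hΩ : IsAdmissibleDomain Ω) (hh : IsCPos Ω h) :
    IsOriginBody (aleksandrovBody Ω h) := by
  obtain ⟨c, hc, hle⟩ := hh.exists_lower_bound hΩ.1
  exact isOriginBody_aleksandrovBody hΩ hc hle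

theorem radialGaussMap_mem_and_isMaxOn (hΩ : IsAdmissibleDomain Ω) (hh : IsCPos Ω h)
    (hv : DifferentiableAt ℝ (gauge (aleksandrovBody Ω h)) v) :
    radialGaussMap (aleksandrovBody Ω h) v ∈ Ω ∧
      IsMaxOn (fun w : Sph n => ⟪(v : EuclideanSpace ℝ (Fin n)), w⟫ / h w) Ω
        (radialGaussMap (aleksandrovBody Ω h) v) := by
  obtain ⟨w, hw, hmax⟩ := hΩ.1.isCompact.exists_isMaxOn (hΩ.nonempty v)
    (continuousOn_inner_div hh v)
  rw [radialGaussMap_eq_of_isMaxOn hΩ (hΩ.isOriginBody hh) hh.2 hv hw hmax]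
  exact ⟨hw, hmax⟩

theorem ae_radialGaussMap_mem (hΩ : IsAdmissibleDomain Ω) (hh : IsCPos Ω h) :
    ∀ᵐ v ∂(sphMeasure n), radialGaussMap (aleksandrovBody Ω h) v ∈ Ω :=
  (hΩ.isOriginBody hh).ae_differentiableAt_gauge.mono fun _ hv =>
    (radialGaussMap_mem_and_isMaxOn hΩ hh hv).1

theorem radialFn_aleksandrovBody_le_mul (hh : IsOriginBody (aleksandrovBody Ω h))
    (hk : IsOriginBody (aleksandrovBody Ω k)) {r : ℝ} (hr : 0 < r) (hle : ∀ w ∈ Ω, h w ≤ r * k w)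
    (v : Sph n) : radialFn (aleksandrovBody Ω h) v ≤ r * radialFn (aleksandrovBody Ω k) v := by
  have hsub : aleksandrovBody Ω h ⊆ r • aleksandrovBody Ω k := fun x hx => by
    refine (mem_smul_set_iff_inv_smul_mem₀ hr.ne' _ _).2 (mem_aleksandrovBody.2 fun w hw => ?_)
    rw [real_inner_smul_left, inv_mul_le_iff₀ hr]
    exact (mem_aleksandrovBody.1 hx w hw).trans (hle w hw)
  have hgauge := gauge_mono (absorbent_nhds_zero hh.mem_nhds_zero) hsub v
  rw [gauge_smul_left_of_nonneg hr.le, Pi.smul_apply, smul_eq_mul, inv_mul_le_iff₀ hr] at hgauge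
  rw [hh.radialFn_eq, hk.radialFn_eq, inv_le_comm₀ (hh.gauge_coe_pos v)
    (mul_pos hr (inv_pos.2 (hk.gauge_coe_pos v))), mul_inv_rev, inv_inv, mul_comm,
    inv_mul_le_iff₀ hr]
  exact hgauge

theorem pos_and_bounds_of_abs_one_sub_div_le {a b δ : ℝ} (ha : 0 < a) (hδ : δ < 1)
    (h : |1 - a / b| ≤ δ) : 0 < b ∧ (1 - δ) * b ≤ a ∧ a ≤ (1 + δ) * b := by
  obtain ⟨hupper, hlower⟩ := abs_le.1 h
  have hb : 0 < b := by
    have hquot : 0 < a / b := by linarith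
    exact (div_pos_iff_of_pos_left ha).1 hquot
  exact ⟨hb, (le_div_iff₀ hb).1 (by linarith), (div_le_iff₀ hb).1 (by linarith)⟩

theorem abs_radialFn_aleksandrovBody_sub_le (hh : IsOriginBody (aleksandrovBody Ω h))
    (hk : IsOriginBody (aleksandrovBody Ω k)) (hpos : ∀ w ∈ Ω, 0 < h w) {δ : ℝ} (hδ₀ : 0 ≤ δ)
    (hδ : δ < 1) (hclose : ∀ w ∈ Ω, |1 - h w / k w| ≤ δ) (v : Sph n) :
    |radialFn (aleksandrovBody Ω k) v - radialFn (aleksandrovBody Ω h) v| ≤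
      δ * radialFn (aleksandrovBody Ω k) v := by
  have hbounds (w) (hw : w ∈ Ω) :=
    (pos_and_bounds_of_abs_one_sub_div_le (hpos w hw) hδ (hclose w hw)).2
  have hδ' : 0 < 1 - δ := sub_pos.2 hδ
  have hupper := radialFn_aleksandrovBody_le_mul hh hk (by linarith)
    (fun w hw => (hbounds w hw).2) v
  have hlower := radialFn_aleksandrovBody_le_mul hk hh (inv_pos.2 hδ')
    (fun w hw => (le_inv_mul_iff₀ hδ').2 (hbounds w hw).1) v
  rw [le_inv_mul_iff₀ hδ'] at hlower
  exact abs_le.2 ⟨by linarith, by linarith⟩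

end AleksandrovBodies

section Variation

section Integrals

variable {X : Type*} [MeasurableSpace X] {μ : Measure X}

theorem hasDerivWithinAt_integral_of_dominated {F : ℝ → X → ℝ} {F' bound : X → ℝ}
    (hF₀ : Integrable (F 0) μ) (hF : ∀ᶠ ε in 𝓝[>] (0 : ℝ), Integrable (F ε) μ)
    (hbound : Integrable bound μ)
    (hlip : ∀ᶠ ε in 𝓝[>] (0 : ℝ), ∀ᵐ x ∂μ, |F ε x - F 0 x| ≤ bound x * ε)
    (hderiv : ∀ᵐ x ∂μ, HasDerivWithinAt (fun ε => F ε x) (F' x) (Ioi 0) 0) :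
    HasDerivWithinAt (fun ε => ∫ x, F ε x ∂μ) (∫ x, F' x ∂μ) (Ioi 0) 0 := by
  rw [hasDerivWithinAt_iff_tendsto_slope' self_notMem_Ioi]
  have hquot : Tendsto (fun ε => ∫ x, slope (fun ε => F ε x) 0 ε ∂μ) (𝓝[>] 0)
      (𝓝 (∫ x, F' x ∂μ)) := by
    refine tendsto_integral_filter_of_dominated_convergence bound ?_ ?_ hbound ?_
    · filter_upwards [hF] with ε hε
      simp only [slope_def_field]
      exact ((hε.sub hF₀).div_const _).aestronglyMeasurable
    · filter_upwards [hlip, self_mem_nhdsWithin] with ε hε (hpos : 0 < ε)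
      filter_upwards [hε] with x hx
      rwa [slope_def_field, sub_zero, norm_div, Real.norm_of_nonneg hpos.le, div_le_iff₀ hpos]
    · filter_upwards [hderiv] with x hx
      exact (hasDerivWithinAt_iff_tendsto_slope' self_notMem_Ioi).1 hx
  refine hquot.congr' ?_
  filter_upwards [hF] with ε hε
  simp only [slope_def_field, integral_div, integral_sub hε hF₀]

end Integrals

section CompactSpace

variable {X : Type*} [TopologicalSpace X] [CompactSpace X] {G : ℝ → X → ℝ} {ρ : ℝ → X → ℝ}

theorem exists_lipschitz_const_of_continuousOn_deriv
    (hGdiff : ∀ t, 0 < t → ∀ x, DifferentiableAt ℝ (fun s => G s x) t)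
    (hGt : ContinuousOn (fun p : ℝ × X => deriv (fun s => G s p.2) p.1) (Ioi 0 ×ˢ univ))
    {a b : ℝ} (ha : 0 < a) :
    ∃ D, 0 ≤ D ∧ ∀ x, ∀ s ∈ Icc a b, ∀ t ∈ Icc a b, |G t x - G s x| ≤ D * |t - s| := by
  have hpos : Icc a b ⊆ Ioi 0 := fun t ht => ha.trans_le ht.1
  obtain ⟨D, hD⟩ := (isCompact_Icc.prod (isCompact_univ (X := X))).exists_bound_of_continuousOn
    (hGt.mono (prod_mono hpos (subset_univ _)))
  exact ⟨max D 0, le_max_right _ _, fun x s hs t ht =>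
    Convex.norm_image_sub_le_of_norm_deriv_le (f := fun s => G s x)
      (fun r hr => hGdiff r (hpos hr) x)
      (fun r hr => (hD (r, x) ⟨hr, mem_univ x⟩).trans (le_max_left _ _)) (convex_Icc a b) hs ht⟩

theorem exists_eventually_mem_Icc {C : ℝ} (hρ₀ : Continuous (ρ 0)) (hpos : ∀ x, 0 < ρ 0 x)
    (hlip : ∀ᶠ ε in 𝓝[>] (0 : ℝ), ∀ x, |ρ ε x - ρ 0 x| ≤ C * ε) :
    ∃ a b, 0 < a ∧ (∀ x, ρ 0 x ∈ Icc a b) ∧ ∀ᶠ ε in 𝓝[>] (0 : ℝ), ∀ x, ρ ε x ∈ Icc a b := by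
  obtain ⟨m, hm, hlower⟩ := isCompact_univ.exists_forall_le' hρ₀.continuousOn fun x _ => hpos x
  obtain ⟨M, hupper⟩ := isCompact_univ.bddAbove_image hρ₀.continuousOn
  replace hlower (x : X) : m ≤ ρ 0 x := hlower x (mem_univ x)
  replace hupper (x : X) : ρ 0 x ≤ M := hupper (mem_image_of_mem _ (mem_univ x))
  have hsmall : ∀ᶠ ε in 𝓝[>] (0 : ℝ), C * ε < m / 2 :=
    nhdsWithin_le_nhds ((continuous_const_mul C).continuousAt.eventually_lt_const (by simpa))
  refine ⟨m / 2, M + m / 2, half_pos hm, fun x => ?_, ?_⟩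
  · constructor <;> linarith [hlower x, hupper x]
  · filter_upwards [hlip, hsmall] with ε hε hCε x
    have hdist := abs_le.1 (hε x)
    constructor <;> linarith [hlower x, hupper x]

variable [MeasurableSpace X] [BorelSpace X] {μ : Measure X} [IsFiniteMeasure μ]

theorem hasDerivWithinAt_integral_comp {ρ' : X → ℝ} {C : ℝ}
    (hG : ContinuousOn (fun p : ℝ × X => G p.1 p.2) (Ioi 0 ×ˢ univ))
    (hGdiff : ∀ t, 0 < t → ∀ x, DifferentiableAt ℝ (fun s => G s x) t)
    (hGt : ContinuousOn (fun p : ℝ × X => deriv (fun s => G s p.2) p.1) (Ioi 0 ×ˢ univ))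
    (hρ₀ : Continuous (ρ 0)) (hpos : ∀ x, 0 < ρ 0 x)
    (hρ : ∀ᶠ ε in 𝓝[>] (0 : ℝ), Continuous (ρ ε))
    (hlip : ∀ᶠ ε in 𝓝[>] (0 : ℝ), ∀ x, |ρ ε x - ρ 0 x| ≤ C * ε)
    (hderiv : ∀ᵐ x ∂μ, HasDerivWithinAt (fun ε => ρ ε x) (ρ' x) (Ioi 0) 0) :
    HasDerivWithinAt (fun ε => ∫ x, G (ρ ε x) x ∂μ)
      (∫ x, deriv (fun s => G s x) (ρ 0 x) * ρ' x ∂μ) (Ioi 0) 0 := by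
  obtain ⟨a, b, ha, hρ₀I, hρI⟩ := exists_eventually_mem_Icc hρ₀ hpos hlip
  obtain ⟨D, hD, hGlip⟩ := exists_lipschitz_const_of_continuousOn_deriv hGdiff hGt (b := b) ha
  have hint {r : X → ℝ} (hr : Continuous r) (hrI : ∀ x, r x ∈ Icc a b) :
      Integrable (fun x => G (r x) x) μ :=
    (hG.comp_continuous (hr.prodMk continuous_id) fun x =>
      ⟨ha.trans_le (hrI x).1, mem_univ x⟩).integrable_of_hasCompactSupport (.of_compactSpace _)
  refine hasDerivWithinAt_integral_of_dominated (bound := fun _ => D * C) (hint hρ₀ hρ₀I) ?_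
    (integrable_const _) ?_ ?_
  · filter_upwards [hρ, hρI] with ε hε hεI using hint hε hεI
  · filter_upwards [hlip, hρI] with ε hε hεI
    refine ae_of_all _ fun x => (hGlip x _ (hρ₀I x) _ (hεI x)).trans ?_
    rw [mul_assoc]
    exact mul_le_mul_of_nonneg_left (hε x) hD
  · filter_upwards [hderiv] with x hx
    exact (hGdiff (ρ 0 x) (hpos x) x).hasDerivAt.comp_hasDerivWithinAt (0 : ℝ) hx

end CompactSpace

section Bodies

theorem exists_eventually_abs_le_mul_of_tendstoUniformlyOn {X : Type*} [TopologicalSpace X]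
    {K : Set X} {F : ℝ → X → ℝ} {g : X → ℝ} (hK : IsCompact K) (hg : ContinuousOn g K)
    (hunif : TendstoUniformlyOn (fun ε x => F ε x / ε) g (𝓝[>] 0) K) :
    ∃ B, 0 < B ∧ ∀ᶠ ε in 𝓝[>] (0 : ℝ), ∀ x ∈ K, |F ε x| ≤ B * ε := by
  obtain ⟨M, hM⟩ := hK.exists_bound_of_continuousOn hg
  refine ⟨max M 0 + 1, by positivity, ?_⟩
  filter_upwards [Metric.tendstoUniformlyOn_iff.1 hunif 1 one_pos, self_mem_nhdsWithin]
    with ε hε (hpos : 0 < ε) x hx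
  rw [← div_le_iff₀ hpos, ← abs_of_pos hpos, ← abs_div, abs_of_pos hpos]
  have hdist := hε x hx
  rw [dist_comm, Real.dist_eq] at hdist
  have htriangle := abs_sub_abs_le_abs_sub (F ε x / ε) (g x)
  have hMx : |g x| ≤ M := hM x hx
  linarith [le_max_left M 0]

theorem tendstoUniformlyOn_mul_left_of_bounded {ι X : Type*} {p : Filter ι} {K : Set X}
    {a g : X → ℝ} {F : ι → X → ℝ} {M : ℝ} (ha : ∀ x ∈ K, |a x| ≤ M)
    (hunif : TendstoUniformlyOn F g p K) :
    TendstoUniformlyOn (fun i x => a x * F i x) (fun x => a x * g x) p K := by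
  rw [Metric.tendstoUniformlyOn_iff] at hunif ⊢
  intro δ hδ
  have hM : 0 < max M 0 + 1 := by positivity
  filter_upwards [hunif (δ / (max M 0 + 1)) (div_pos hδ hM)] with i hi x hx
  have hMx : |a x| ≤ max M 0 + 1 := (ha x hx).trans (by linarith [le_max_left M 0])
  calc dist (a x * g x) (a x * F i x) = |a x| * dist (g x) (F i x) := by
        rw [Real.dist_eq, Real.dist_eq, ← mul_sub, abs_mul]
    _ ≤ (max M 0 + 1) * dist (g x) (F i x) := by gcongr
    _ < δ := by rw [mul_comm]; exact (lt_div_iff₀ hM).1 (hi x hx)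

variable {n : ℕ} {Ω : Set (Sph n)} {h : ℝ → Sph n → ℝ} {g : Sph n → ℝ} {G : ℝ → Sph n → ℝ}

theorem exists_eventually_radialFn_lipschitz (hΩ : IsAdmissibleDomain Ω) (hh : IsCPos Ω (h 0))
    (hg : ContinuousOn g Ω)
    (hunif : TendstoUniformlyOn (fun ε u => (1 - h 0 u / h ε u) / ε) g (𝓝[>] 0) Ω) :
    ∃ C, ∀ᶠ ε in 𝓝[>] (0 : ℝ), (∀ w ∈ Ω, 0 < h ε w) ∧ IsOriginBody (aleksandrovBody Ω (h ε)) ∧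
      ∀ v, |radialFn (aleksandrovBody Ω (h ε)) v - radialFn (aleksandrovBody Ω (h 0)) v| ≤
        C * ε := by
  obtain ⟨B, hB, hclose⟩ := exists_eventually_abs_le_mul_of_tendstoUniformlyOn hΩ.1.isCompact hg
    hunif
  obtain ⟨c, hc, hlower⟩ := hh.exists_lower_bound hΩ.1
  have hbody := hΩ.isOriginBody hh
  obtain ⟨R, hR⟩ := isCompact_univ.bddAbove_image hbody.continuous_radialFn.continuousOn
  have hsmall : ∀ᶠ ε in 𝓝[>] (0 : ℝ), B * ε < 1 / 2 :=
    nhdsWithin_le_nhds ((continuous_const_mul B).continuousAt.eventually_lt_const (by simp))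
  refine ⟨2 * B * R, ?_⟩
  filter_upwards [hclose, hsmall, self_mem_nhdsWithin] with ε hε hBε (hpos : 0 < ε)
  have hbounds (w) (hw : w ∈ Ω) :=
    pos_and_bounds_of_abs_one_sub_div_le (hh.2 w hw) (by linarith) (hε w hw)
  have hbodyε : IsOriginBody (aleksandrovBody Ω (h ε)) := by
    refine isOriginBody_aleksandrovBody hΩ (half_pos hc) fun w hw => ?_
    nlinarith [hbounds w hw, hlower w hw]
  refine ⟨fun w hw => (hbounds w hw).1, hbodyε, fun v => ?_⟩
  have hdist := abs_radialFn_aleksandrovBody_sub_le hbody hbodyε hh.2 (by positivity)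
    (by linarith) hε v
  have hRv : radialFn (aleksandrovBody Ω (h 0)) v ≤ R := hR (mem_image_of_mem _ (mem_univ v))
  have hdouble : radialFn (aleksandrovBody Ω (h ε)) v ≤ 2 * R := by
    nlinarith [(abs_le.1 hdist).2, hbodyε.radialFn_pos v]
  calc _ ≤ B * ε * radialFn (aleksandrovBody Ω (h ε)) v := hdist
    _ ≤ B * ε * (2 * R) := by gcongr
    _ = 2 * B * R * ε := by ring

theorem hasDerivWithinAt_gauge_aleksandrovBody (hΩ : IsAdmissibleDomain Ω) (hh : IsCPos Ω (h 0))
    (hg : ContinuousOn g Ω)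
    (hunif : TendstoUniformlyOn (fun ε u => (1 - h 0 u / h ε u) / ε) g (𝓝[>] 0) Ω) {v : Sph n}
    (hv : DifferentiableAt ℝ (gauge (aleksandrovBody Ω (h 0))) v) :
    HasDerivWithinAt (fun ε => gauge (aleksandrovBody Ω (h ε)) v)
      (-(gauge (aleksandrovBody Ω (h 0)) v * g (radialGaussMap (aleksandrovBody Ω (h 0)) v)))
      (Ioi 0) 0 := by
  set a : Sph n → ℝ := fun w => ⟪(v : EuclideanSpace ℝ (Fin n)), w⟫ / h 0 w
  have hbody := hΩ.isOriginBody hh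
  have ha : ContinuousOn a Ω := continuousOn_inner_div hh v
  obtain ⟨hmem, hmax⟩ := radialGaussMap_mem_and_isMaxOn hΩ hh hv
  have hgauge₀ := gauge_aleksandrovBody hΩ hbody.mem_nhds_zero hh.2 v
  obtain ⟨C, hC⟩ := exists_eventually_radialFn_lipschitz hΩ hh hg hunif
  obtain ⟨M, hM⟩ := hΩ.1.isCompact.exists_bound_of_continuousOn ha
  have hquot : TendstoUniformlyOn
      (fun ε (w : Sph n) => (⟪(v : EuclideanSpace ℝ (Fin n)), w⟫ / h ε w - a w) / ε)
      (fun w => -a w * g w) (𝓝[>] 0) Ω := by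
    refine (tendstoUniformlyOn_mul_left_of_bounded (a := fun w => -a w)
      (fun w hw => (abs_neg (a w)).trans_le (hM w hw)) hunif).congr (.of_forall fun ε w hw => ?_)
    have hw₀ : h 0 w ≠ 0 := (hh.2 w hw).ne'
    simp only [a]
    field_simp
    ring
  have hderiv := hasDerivWithinAt_iSup_of_tendstoUniformlyOn
    (A := fun ε (w : Sph n) => ⟪(v : EuclideanSpace ℝ (Fin n)), w⟫ / h ε w) hΩ.1.isCompact ha
    (ha.neg.mul hg) hmem
    (fun w hw hwmax => (radialGaussMap_eq_of_isMaxOn hΩ hbody hh.2 hv hw hwmax).symm) hquot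
  have hvalue : a (radialGaussMap (aleksandrovBody Ω (h 0)) v) =
      gauge (aleksandrovBody Ω (h 0)) v := by
    rw [hgauge₀, hmax.iSup_eq hmem]
  rw [← hvalue, ← neg_mul]
  refine hderiv.congr_of_eventuallyEq ?_ hgauge₀
  filter_upwards [hC] with ε hε
  exact gauge_aleksandrovBody hΩ hε.2.1.mem_nhds_zero hε.1 v

theorem hasDerivWithinAt_radialFn_aleksandrovBody (hΩ : IsAdmissibleDomain Ω)
    (hh : IsCPos Ω (h 0)) (hg : ContinuousOn g Ω)
    (hunif : TendstoUniformlyOn (fun ε u => (1 - h 0 u / h ε u) / ε) g (𝓝[>] 0) Ω) {v : Sph n}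
    (hv : DifferentiableAt ℝ (gauge (aleksandrovBody Ω (h 0))) v) :
    HasDerivWithinAt (fun ε => radialFn (aleksandrovBody Ω (h ε)) v)
      (radialFn (aleksandrovBody Ω (h 0)) v * g (radialGaussMap (aleksandrovBody Ω (h 0)) v))
      (Ioi 0) 0 := by
  have hbody := hΩ.isOriginBody hh
  obtain ⟨C, hC⟩ := exists_eventually_radialFn_lipschitz hΩ hh hg hunif
  have hgauge := (hbody.gauge_coe_pos v).ne'
  have hderiv := (hasDerivWithinAt_gauge_aleksandrovBody hΩ hh hg hunif hv).fun_inv hgauge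
  refine (hderiv.congr_of_eventuallyEq ?_ (hbody.radialFn_eq v)).congr_deriv ?_
  · filter_upwards [hC] with ε hε using hε.2.1.radialFn_eq v
  · rw [hbody.radialFn_eq]
    field_simp

theorem hasDerivWithinAt_dualVolume_aleksandrovBody (hΩ : IsAdmissibleDomain Ω)
    (hh : IsCPos Ω (h 0)) (hg : ContinuousOn g Ω)
    (hunif : TendstoUniformlyOn (fun ε u => (1 - h 0 u / h ε u) / ε) g (𝓝[>] 0) Ω)
    (hG : ContinuousOn (fun p : ℝ × Sph n => G p.1 p.2) (Ioi 0 ×ˢ univ))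
    (hGdiff : ∀ t, 0 < t → ∀ u, DifferentiableAt ℝ (fun s => G s u) t)
    (hGt : ContinuousOn (fun p : ℝ × Sph n => partialT G p.1 p.2) (Ioi 0 ×ˢ univ)) :
    HasDerivWithinAt (fun ε => dualVolume G (aleksandrovBody Ω (h ε)))
      (∫ v, g (radialGaussMap (aleksandrovBody Ω (h 0)) v) *
        dualCurvatureDensity G (aleksandrovBody Ω (h 0)) v ∂(sphMeasure n)) (Ioi 0) 0 := by
  have hbody := hΩ.isOriginBody hh
  obtain ⟨C, hC⟩ := exists_eventually_radialFn_lipschitz hΩ hh hg hunif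
  have hderiv := hasDerivWithinAt_integral_comp (μ := sphMeasure n)
    (ρ := fun ε => radialFn (aleksandrovBody Ω (h ε))) hG hGdiff hGt hbody.continuous_radialFn
    hbody.radialFn_pos (hC.mono fun ε hε => hε.2.1.continuous_radialFn)
    (hC.mono fun ε hε => hε.2.2) (hbody.ae_differentiableAt_gauge.mono fun v hv =>
      hasDerivWithinAt_radialFn_aleksandrovBody hΩ hh hg hunif hv)
  refine hderiv.congr_deriv (integral_congr_ae (.of_forall fun v => ?_))
  simp only [dualCurvatureDensity, partialT]
  ring

end Bodies

end Variation

theorem setIntegral_dualCurvatureMeasure_aleksandrovBody {n : ℕ} {Ω : Set (Sph n)}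
    {f ψ : Sph n → ℝ} {G : ℝ → Sph n → ℝ} (hΩ : IsAdmissibleDomain Ω) (hf : IsCPos Ω f)
    (hGt : ContinuousOn (fun p : ℝ × Sph n => partialT G p.1 p.2) (Ioi 0 ×ˢ univ))
    (hψ : ContinuousOn ψ Ω) :
    ∫ᵛ u in Ω, ψ u ∂•(dualCurvatureMeasure G (aleksandrovBody Ω f)) = 1 / (n : ℝ) *
      ∫ v, ψ (radialGaussMap (aleksandrovBody Ω f) v) *
        dualCurvatureDensity G (aleksandrovBody Ω f) v ∂(sphMeasure n) := by
  rw [(hΩ.isOriginBody hf).setIntegral_dualCurvatureMeasure hGt hΩ.1 hψ,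
    Measure.restrict_eq_self_of_ae_mem
      (s := radialGaussMap (aleksandrovBody Ω f) ⁻¹' Ω) (ae_radialGaussMap_mem hΩ hf)]

theorem mainTheorem3_general {n : ℕ} (hn : 0 < n) {Ω : Set (Sph n)} (hΩ : IsAdmissibleDomain Ω)
    {h₁ h₂ : Sph n → ℝ} (hh₁ : IsCPos Ω h₁) (hh₂ : IsCPos Ω h₂) {φ₁ φ₂ : ℝ → ℝ} {d : ℝ}
    (hφ : IsOrliczPair φ₁ φ₂) (hderiv : HasDerivAt φ₁ d 1) (hd : d ≠ 0) {G : ℝ → Sph n → ℝ}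
    (hG : ContinuousOn (fun p : ℝ × Sph n => G p.1 p.2) (Ioi 0 ×ˢ univ))
    (hGdiff : ∀ t, 0 < t → ∀ u, DifferentiableAt ℝ (fun s => G s u) t)
    (hGt : ContinuousOn (fun p : ℝ × Sph n => partialT G p.1 p.2) (Ioi 0 ×ˢ univ))
    {h : ℝ → Sph n → ℝ} (hh : ∀ ε, 0 < ε → IsOrliczCombination Ω φ₁ φ₂ h₁ h₂ ε (h ε)) :
    (∀ E : Set (Sph n), MeasurableSet E →
      NullMeasurableSet (reverseRadialGaussImage (aleksandrovBody Ω h₁) E) (sphMeasure n) ∧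
      dualCurvatureMeasure G (aleksandrovBody Ω h₁) E =
        dualCurvatureSetFn G (aleksandrovBody Ω h₁) E) ∧
    Tendsto
      (fun ε : ℝ => (dualVolume G (aleksandrovBody Ω (h ε))
        - dualVolume G (aleksandrovBody Ω h₁)) / ε)
      (𝓝[>] 0)
      (𝓝 ((n : ℝ) / d *
        ∫ᵛ u in Ω, φ₂ (h₂ u / h₁ u) ∂•(dualCurvatureMeasure G (aleksandrovBody Ω h₁)))) := by
  have hbody := hΩ.isOriginBody hh₁
  refine ⟨fun E hE => ⟨hbody.nullMeasurableSet_reverseRadialGaussImage hE,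
    hbody.dualCurvatureMeasure_apply hGt hE⟩, ?_⟩
  have hψ : ContinuousOn (fun u => φ₂ (h₂ u / h₁ u)) Ω :=
    hφ.cont.comp (hh₂.1.div hh₁.1 fun u hu => (hh₁.2 u hu).ne')
      fun u hu => div_pos (hh₂.2 u hu) (hh₁.2 u hu)
  have hexpansion := tendstoUniformlyOn_orlicz_expansion hφ hderiv hd hΩ.1 hh₁ hh₂ hh
  -- The equation says nothing about `h 0`; the one-sided derivative at `0` needs it to be `h₁`.
  set k := Function.update h 0 h₁
  have hk₀ : k 0 = h₁ := Function.update_self ..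
  have hk : ∀ ε ∈ Ioi (0 : ℝ), k ε = h ε := fun ε hε => Function.update_of_ne hε.ne' ..
  have hvolume := hasDerivWithinAt_dualVolume_aleksandrovBody (h := k) hΩ (hk₀ ▸ hh₁)
    (hψ.div_const d) (hexpansion.congr (eventually_mem_nhdsWithin.mono fun ε hε u _ => by
      simp only [hk₀, hk ε hε])) hG hGdiff hGt
  rw [hasDerivWithinAt_iff_tendsto_slope' self_notMem_Ioi, hk₀] at hvolume
  have hlimit := hvolume.congr' (eventually_mem_nhdsWithin.mono fun ε hε => by
    rw [slope_def_field, hk₀, hk ε hε, sub_zero])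
  rw [setIntegral_dualCurvatureMeasure_aleksandrovBody hΩ hh₁ hGt hψ, ← mul_assoc,
    show (n : ℝ) / d * (1 / n) = d⁻¹ by field_simp, ← integral_const_mul]
  simpa only [div_eq_inv_mul, mul_assoc] using hlimit

end DualOrlicz

end

open DualOrlicz in
/-- The first conjunct says that `C̃_G([h₁], ·)` is well defined, the second one is the
variational formula. -/
theorem mainTheorem3 (n : ℕ) (hn : 0 < n)
    (Ω : Set (Sph n)) (hΩ : IsAdmissibleDomain Ω)
    (h₁ h₂ : Sph n → ℝ) (hh₁ : IsCPos Ω h₁) (hh₂ : IsCPos Ω h₂)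
    (φ₁ φ₂ : ℝ → ℝ)
    (hφ : (IsClassI φ₁ ∧ IsClassI φ₂) ∨ (IsClassD φ₁ ∧ IsClassD φ₂))
    (hφ₁ : ContDiffOn ℝ 1 φ₁ (Ioi 0)) (hφ₁' : ∀ t, 0 < t → deriv φ₁ t ≠ 0)
    (hφ₂ : ContDiffOn ℝ 1 φ₂ (Ioi 0)) (hφ₂' : ∀ t, 0 < t → deriv φ₂ t ≠ 0)
    (G : ℝ → Sph n → ℝ)
    (hG : ContinuousOn (fun p : ℝ × Sph n => G p.1 p.2) (Ioi 0 ×ˢ univ))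
    (hGdiff : ∀ t, 0 < t → ∀ u, DifferentiableAt ℝ (fun s => G s u) t)
    (hGt : ContinuousOn (fun p : ℝ × Sph n => partialT G p.1 p.2) (Ioi 0 ×ˢ univ))
    (h : ℝ → Sph n → ℝ)
    (hh : ∀ ε, 0 < ε → IsOrliczCombination Ω φ₁ φ₂ h₁ h₂ ε (h ε)) :
    (∀ E : Set (Sph n), MeasurableSet E →
      NullMeasurableSet (reverseRadialGaussImage (aleksandrovBody Ω h₁) E) (sphMeasure n) ∧
      dualCurvatureMeasure G (aleksandrovBody Ω h₁) E =
        (1 / (n : ℝ)) * ∫ u in reverseRadialGaussImage (aleksandrovBody Ω h₁) E,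
          radialFn (aleksandrovBody Ω h₁) u *
            partialT G (radialFn (aleksandrovBody Ω h₁) u) u ∂(sphMeasure n)) ∧
    Tendsto
      (fun ε : ℝ => (dualVolume G (aleksandrovBody Ω (h ε))
        - dualVolume G (aleksandrovBody Ω h₁)) / ε)
      (𝓝[>] 0)
      (𝓝 ((n : ℝ) / deriv φ₁ 1 *
        ∫ᵛ u in Ω, φ₂ (h₂ u / h₁ u) ∂•(dualCurvatureMeasure G (aleksandrovBody Ω h₁)))) := by
  have hderiv : HasDerivAt φ₁ (deriv φ₁ 1) 1 :=
    ((hφ₁.differentiableOn one_ne_zero).differentiableAt (Ioi_mem_nhds one_pos)).hasDerivAt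
  exact mainTheorem3_general hn hΩ hh₁ hh₂ (isOrliczPair_of_classes hφ) hderiv (hφ₁' 1 one_pos)
    hG hGdiff hGt hh
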